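/- Let $V$ be a complex vector space of finite dimension at least $2$, let $q$ be a nonzero quadratic form on $V$, and let $Q=\{q=0\}\subset\mathbb P V$ be the corresponding quadric hypersurface (as a scheme, in the projective space of lines in $V$). Let $\mathrm{Cl}=T(V)/\langle v^2=q(v)\rangle$ be the Clifford algebra with its $\mathbb Z/2$-grading. For a $\mathbb Z/2$-graded left $\mathrm{Cl}$-module $I=I_{\mathrm{ev}}\oplus I_{\mathrm{odd}}$ let $S$ be the sheaf on $Q$ that is the cokernel of $$\varphi:\ \mathcal O(-1)\otimes I_{\mathrm{ev}}\to\mathcal O\otimes I_{\mathrm{odd}},\qquad v\otimes\xi\mapsto 1\otimes v\xi .$$ (The cokernel of this map on $\mathbb P V$ is annihilated by $q$, and regarded as a sheaf on $Q$ it is the cokernel of the restriction of the map to $Q$.) A homomorphism $f:I\to I'$ of $\mathrm{Cl}$-modules that preserves the grading induces $1\otimes f_{\mathrm{ev}}$ and $1\otimes f_{\mathrm{odd}}$, which commute with $\varphi,\varphi'$, and hence induces a map $S\to S'$ on cokernels; this makes $I\mapsto S$ a functor from graded $\mathrm{Cl}$-modules to sheaves of $\mathcal O_Q$-modules. Let $W,W'\subset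 V$ be isotropic subspaces with bases $w_1,\dots,w_m$ and $w'_1,\dots,w'_{m'}$, and let $I=\mathrm{Cl}\cdot w_1\cdots w_m$ and $I'=\mathrm{Cl}\cdot w'_1\cdots w'_{m'}$ be the corresponding left ideals, graded by their intersections with $\mathrm{Cl}_{\mathrm{ev}}$ and $\mathrm{Cl}_{\mathrm{odd}}$. Then the natural $\mathbb C$-linear map $$\mathrm{Hom}_{\mathrm{Cl}}(I,I')\to\mathrm{Hom}_Q(S,S')$$ from grading-preserving $\mathrm{Cl}$-module homomorphisms to homomorphisms of $\mathcal O_Q$-modules is an isomorphism. More generally, the same holds for all graded $\mathrm{Cl}$-modules $I,I'$, so the functor from graded $\mathrm{Cl}$-modules to sheaves on $Q$ is $\mathbb C$-linear and fully faithful. -/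

import Mathlib

open CategoryTheory AlgebraicGeometry TopologicalSpace
open scoped TensorProduct

universe u

noncomputable section

namespace SpinorSheaf

section Sheaves

variable {A : Type u} [CommRing A] [Algebra ℂ A] (𝒜 : ℕ → Submodule ℂ A) [GradedAlgebra 𝒜]
variable (E : Type u) [AddCommGroup E] [Module ℂ E]

/-- The degree `i` part `𝒜 i ⊗ E` of the graded `A`-module `A ⊗ E`. -/
def tensorDegree (i : ℕ) : Submodule ℂ (A ⊗[ℂ] E) :=
  LinearMap.range (LinearMap.rTensor E (𝒜 i).subtype)

variable {𝒜 E} in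
theorem smul_mem_tensorDegree {i j : ℕ} {a : A} (ha : a ∈ 𝒜 i) {n : A ⊗[ℂ] E}
    (hn : n ∈ tensorDegree 𝒜 E j) : a • n ∈ tensorDegree 𝒜 E (i + j) := by
  obtain ⟨t, rfl⟩ := hn
  induction t with
  | zero => simp
  | add x y hx hy => rw [map_add, smul_add]; exact add_mem hx hy
  | tmul r e =>
    refine ⟨(⟨a * r, SetLike.mul_mem_graded ha r.2⟩ : 𝒜 (i + j)) ⊗ₜ e, ?_⟩
    simp [TensorProduct.smul_tmul']

variable {𝒜} in
/-- The complement of the homogeneous prime ideal `x`. -/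
abbrev complAt (x : ProjectiveSpectrum 𝒜) : Submonoid A := x.asHomogeneousIdeal.toIdeal.primeCompl

/-- The localization of `A ⊗ E` at the homogeneous prime ideal `x`. -/
abbrev LocAt (x : ProjectiveSpectrum 𝒜) : Type u := LocalizedModule (complAt x) (A ⊗[ℂ] E)

/-- `f` is given on `U` by a single fraction `n / s` of degree `d`. -/
def IsFractionOfDegree (d : ℤ) {U : Opens (ProjectiveSpectrum 𝒜)}
    (f : ∀ x : U, LocAt 𝒜 E x.1) : Prop :=
  ∃ (i j : ℕ) (n : A ⊗[ℂ] E) (s : A), (i : ℤ) = j + d ∧ n ∈ tensorDegree 𝒜 E i ∧ s ∈ 𝒜 j ∧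
    ∀ x : U, ∃ hs : s ∈ complAt x.1, f x = LocalizedModule.mk n ⟨s, hs⟩

/-- Being a fraction of degree `d` is stable under restriction. -/
def fractionPrelocal (d : ℤ) :
    TopCat.PrelocalPredicate fun x : ProjectiveSpectrum.top 𝒜 => LocAt 𝒜 E x where
  pred {U} f := IsFractionOfDegree 𝒜 E d (U := U) f
  res := by
    rintro V U i f ⟨k, j, n, s, h, hn, hs, w⟩
    exact ⟨k, j, n, s, h, hn, hs, fun x => w (i x)⟩

/-- Being locally a fraction of degree `d`. -/
def locallyFraction (d : ℤ) :
    TopCat.LocalPredicate fun x : ProjectiveSpectrum.top 𝒜 => LocAt 𝒜 E x :=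
  (fractionPrelocal 𝒜 E d).sheafify

variable {𝒜} in
theorem exists_mem_compl (x : ProjectiveSpectrum 𝒜) (N : ℕ) :
    ∃ j s, N ≤ j ∧ s ∈ 𝒜 j ∧ s ∈ complAt x := by
  obtain ⟨f, m, f_deg, hm, hx⟩ : ∃ (f : A) (m : ℕ), f ∈ 𝒜 m ∧ 0 < m ∧ f ∉ x.1 := by
    by_contra! h
    refine x.not_irrelevant_le fun z hz ↦ ?_
    classical
    rw [← DirectSum.sum_support_decompose 𝒜 z]
    refine x.1.toIdeal.sum_mem fun k hk ↦ ?_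
    rcases Nat.eq_zero_or_pos k with rfl | hk'
    · have : (DirectSum.decompose 𝒜 z 0 : A) = 0 := hz
      rw [this]; exact zero_mem _
    · exact h _ k (SetLike.coe_mem _) hk'
  refine ⟨N • m, f ^ N, ?_, SetLike.pow_mem_graded N f_deg, pow_mem (S := complAt x) hx N⟩
  rw [smul_eq_mul]; exact Nat.le_mul_of_pos_right N hm

/-- The sections of `𝒪(d) ⊗ E` over `U`: functions sending `x ∈ U` to an element of the
localization of `A ⊗ E` at `x`, locally given by fractions of degree `d`. -/
def twistSections (d : ℤ) (U : Opens (ProjectiveSpectrum 𝒜)) :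
    AddSubgroup (∀ x : U, LocAt 𝒜 E x.1) where
  carrier := {f | (locallyFraction 𝒜 E d).pred (U := U) f}
  zero_mem' := fun x => by
    obtain ⟨j, s, hj, hs, hx⟩ := exists_mem_compl x.1 (-d).toNat
    refine ⟨U ⊓ ProjectiveSpectrum.basicOpen 𝒜 s, ⟨x.2, hx⟩, Opens.infLELeft _ _,
      (j + d).toNat, j, 0, s, by omega, zero_mem _, hs, fun y => ⟨y.2.2, ?_⟩⟩
    exact (LocalizedModule.zero_mk _).symm
  add_mem' := fun {a b} ha hb x => by
    obtain ⟨Va, ma, ia, k, j, n, s, h, hn, hs, w⟩ := ha x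
    obtain ⟨Vb, mb, ib, k', j', n', s', h', hn', hs', w'⟩ := hb x
    refine ⟨Va ⊓ Vb, ⟨ma, mb⟩, Opens.infLELeft _ _ ≫ ia, (j' + k), (j + j'),
      s' • n + s • n', s * s', by push_cast; omega,
      add_mem (smul_mem_tensorDegree hs' hn) ?_, SetLike.mul_mem_graded hs hs', fun y => ?_⟩
    · have : j' + k = j + k' := by omega
      rw [this]; exact smul_mem_tensorDegree hs hn'
    · obtain ⟨h1, e1⟩ := w ⟨y.1, y.2.1⟩
      obtain ⟨h2, e2⟩ := w' ⟨y.1, y.2.2⟩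
      exact ⟨mul_mem h1 h2, congr($e1 + $e2).trans (LocalizedModule.mk_add_mk ..)⟩
  neg_mem' := fun {a} ha x => by
    obtain ⟨V, m, i, k, j, n, s, h, hn, hs, w⟩ := ha x
    refine ⟨V, m, i, k, j, -n, s, h, neg_mem hn, hs, fun y => ?_⟩
    obtain ⟨h1, e1⟩ := w y
    exact ⟨h1, congr(-$e1).trans (LocalizedModule.mk_neg ..).symm⟩

/-- The ring of sections of the structure sheaf of `Proj 𝒜` over `U`. -/
abbrev regularFunctions (U : Opens (ProjectiveSpectrum 𝒜)) : Type u :=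
  (ProjectiveSpectrum.Proj.structureSheaf 𝒜).1.obj (Opposite.op (α := Opens (ProjectiveSpectrum.top 𝒜)) U)

variable {𝒜} in
/-- The value at `x ∈ U` of a regular function on `U`. -/
def valueAt {U : Opens (ProjectiveSpectrum 𝒜)} (r : regularFunctions 𝒜 U) (x : U) :
    Localization (complAt x.1) :=
  HomogeneousLocalization.val (r.1 x)

theorem smul_mem_sections (d : ℤ) (U : Opens (ProjectiveSpectrum 𝒜))
    (r : regularFunctions 𝒜 U) (f : ∀ x : U, LocAt 𝒜 E x.1)
    (hf : f ∈ twistSections 𝒜 E d U) : (fun x => valueAt r x • f x) ∈ twistSections 𝒜 E d U := by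
  intro x
  obtain ⟨V, mV, iV, l, a, b, hb, e⟩ := r.2 x
  obtain ⟨W, mW, iW, k, j, n, s, h, hn, hs, w⟩ := hf x
  refine ⟨V ⊓ W, ⟨mV, mW⟩, Opens.infLELeft _ _ ≫ iV, l + k, l + j, a.1 • n, b.1 * s,
    by push_cast; omega, smul_mem_tensorDegree a.2 hn, SetLike.mul_mem_graded b.2 hs,
    fun y => ?_⟩
  obtain ⟨h1, e1⟩ := w ⟨y.1, y.2.2⟩
  have e2 := e ⟨y.1, y.2.1⟩
  refine ⟨mul_mem (show b.1 ∈ complAt y.1 from hb ⟨y.1, y.2.1⟩) h1, ?_⟩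
  have e3 := congr(HomogeneousLocalization.val $e2)
  rw [HomogeneousLocalization.val_mk] at e3
  exact congr($e3 • $e1).trans (LocalizedModule.mk_smul_mk ..)

/-- The action of regular functions on the sections of `𝒪(d) ⊗ E`. -/
instance sectionsModule (d : ℤ) (U : Opens (ProjectiveSpectrum 𝒜)) :
    Module (regularFunctions 𝒜 U) (twistSections 𝒜 E d U) where
  smul r f := ⟨fun x => valueAt r x • f.1 x, smul_mem_sections 𝒜 E d U r f.1 f.2⟩
  one_smul f := Subtype.ext <| funext fun x =>
    congr($(HomogeneousLocalization.val_one) • f.1 x).trans (one_smul _ _)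
  mul_smul r s f := Subtype.ext <| funext fun x =>
    congr($(HomogeneousLocalization.val_mul (r.1 x) (s.1 x)) • f.1 x).trans (mul_smul _ _ _)
  smul_zero _ := Subtype.ext <| funext fun _ => smul_zero _
  smul_add _ _ _ := Subtype.ext <| funext fun _ => smul_add _ _ _
  add_smul r s f := Subtype.ext <| funext fun x =>
    congr($(HomogeneousLocalization.val_add (r.1 x) (s.1 x)) • f.1 x).trans (add_smul _ _ _)
  zero_smul f := Subtype.ext <| funext fun x =>
    congr($(HomogeneousLocalization.val_zero) • f.1 x).trans (zero_smul _ _)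

/-- `𝒪(d) ⊗ E` as a presheaf of abelian groups. -/
def abPresheaf (d : ℤ) : (Proj 𝒜).Opensᵒᵖ ⥤ Ab.{u} where
  obj U := .of (twistSections 𝒜 E d U.unop)
  map i := AddCommGrpCat.ofHom
    { toFun := fun f => ⟨fun x => f.1 (i.unop x), (locallyFraction 𝒜 E d).res i.unop f.1 f.2⟩
      map_zero' := rfl
      map_add' := fun _ _ => rfl }

instance abPresheafModule (d : ℤ) (U : (Proj 𝒜).Opensᵒᵖ) :
    Module ((Proj 𝒜).ringCatSheaf.obj.obj U) ((abPresheaf 𝒜 E d).obj U) :=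
  sectionsModule 𝒜 E d U.unop

/-- `𝒪(d) ⊗ E` as a presheaf of sets is the sheaf of functions that are locally fractions of
degree `d`. -/
def abPresheafForget (d : ℤ) : abPresheaf 𝒜 E d ⋙ forget Ab ≅
    (TopCat.subsheafToTypes (locallyFraction 𝒜 E d)).1 :=
  NatIso.ofComponents (fun _ => Iso.refl _) fun _ => rfl

/-- The sheaf of modules `𝒪(d) ⊗ E` on `Proj 𝒜`. -/
def twist (d : ℤ) : (Proj 𝒜).Modules where
  val := .ofPresheaf (R := (Proj 𝒜).ringCatSheaf.obj) (abPresheaf 𝒜 E d) fun _ _ _ _ _ ↦ rfl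
  isSheaf := (TopCat.Presheaf.isSheaf_iff_isSheaf_comp (forget AddCommGrpCat) _).2
    (TopCat.Presheaf.isSheaf_of_iso (abPresheafForget 𝒜 E d).symm
      (TopCat.subsheafToTypes (locallyFraction 𝒜 E d)).2)

/-- The constant function on the open subset `U` of `Proj 𝒜` with value `c`. -/
def constSection (c : ℂ) (U : (Proj 𝒜).Opens) : Γ(Proj 𝒜, U) :=
  show regularFunctions 𝒜 U from
  ⟨fun _ => HomogeneousLocalization.mk
      ⟨0, ⟨algebraMap ℂ A c, SetLike.algebraMap_mem_graded 𝒜 c⟩, ⟨1, SetLike.one_mem_graded 𝒜⟩,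
        one_mem _⟩,
    fun x => ⟨U, x.2, 𝟙 U, 0, ⟨algebraMap ℂ A c, SetLike.algebraMap_mem_graded 𝒜 c⟩,
      ⟨1, SetLike.one_mem_graded 𝒜⟩, fun y => one_mem (complAt y.1), fun _ => rfl⟩⟩

variable {𝒜 E}
variable {E' : Type u} [AddCommGroup E'] [Module ℂ E']

theorem map_mem_sections {d d' : ℤ} (f : A ⊗[ℂ] E →ₗ[A] A ⊗[ℂ] E') {m : ℕ} (hd : d' = d + m)
    (hf : ∀ i, ∀ n ∈ tensorDegree 𝒜 E i, f n ∈ tensorDegree 𝒜 E' (i + m))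
    (U : Opens (ProjectiveSpectrum 𝒜)) (g : twistSections 𝒜 E d U) :
    (fun x : U => LocalizedModule.map (complAt x.1) f (g.1 x)) ∈ twistSections 𝒜 E' d' U := by
  intro x
  obtain ⟨V, mV, iV, k, j, n, s, h, hn, hs, w⟩ := g.2 x
  refine ⟨V, mV, iV, k + m, j, f n, s, by push_cast; omega, hf _ _ hn, hs, fun y => ?_⟩
  obtain ⟨h1, e1⟩ := w y
  exact ⟨h1, congr(LocalizedModule.map (complAt y.1) f $e1).trans (LocalizedModule.map_mk ..)⟩

/-- The morphism `𝒪(d) ⊗ E ⟶ 𝒪(d + m) ⊗ E'` induced by an `A`-linear map `A ⊗ E → A ⊗ E'` that is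
homogeneous of degree `m`. -/
def twistMap {d d' : ℤ} (f : A ⊗[ℂ] E →ₗ[A] A ⊗[ℂ] E') {m : ℕ} (hd : d' = d + m)
    (hf : ∀ i, ∀ n ∈ tensorDegree 𝒜 E i, f n ∈ tensorDegree 𝒜 E' (i + m)) :
    twist 𝒜 E d ⟶ twist 𝒜 E' d' where
  val := PresheafOfModules.homMk
    { app := fun U => AddCommGrpCat.ofHom
        { toFun := fun g => ⟨fun x => LocalizedModule.map (complAt x.1) f (g.1 x),
            map_mem_sections f hd hf U.unop g⟩
          map_zero' := Subtype.ext <| funext fun _ => map_zero _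
          map_add' := fun _ _ => Subtype.ext <| funext fun _ => map_add _ _ _ }
      naturality := fun _ _ _ => rfl } fun _ _ g =>
        Subtype.ext <| funext fun x => map_smul (LocalizedModule.map (complAt x.1) f) _ (g.1 x)

variable {E'' : Type u} [AddCommGroup E''] [Module ℂ E'']

theorem baseChange_mem_tensorDegree (f : E →ₗ[ℂ] E') (i : ℕ) (n : A ⊗[ℂ] E)
    (hn : n ∈ tensorDegree 𝒜 E i) : f.baseChange A n ∈ tensorDegree 𝒜 E' i := by
  obtain ⟨t, rfl⟩ := hn
  induction t with
  | zero => simp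
  | add x y hx hy => rw [map_add, map_add]; exact add_mem hx hy
  | tmul r e => exact ⟨r ⊗ₜ f e, by simp⟩

variable (𝒜) in
/-- The morphism `𝒪(d) ⊗ E ⟶ 𝒪(d) ⊗ E'` induced by a linear map `E → E'`. -/
def twistBaseChange (d : ℤ) (f : E →ₗ[ℂ] E') : twist 𝒜 E d ⟶ twist 𝒜 E' d :=
  twistMap (f.baseChange A) (m := 0) (by simp) (baseChange_mem_tensorDegree f)

theorem twist_hom_ext {d d' : ℤ} {g h : twist 𝒜 E d ⟶ twist 𝒜 E' d'}
    (H : ∀ (U : Opens (ProjectiveSpectrum 𝒜)) (s : twistSections 𝒜 E d U),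
      (g.app U).hom s = (h.app U).hom s) : g = h :=
  Scheme.Modules.hom_ext _ _ fun U => by
    ext s
    exact H U s

theorem twistBaseChange_id (d : ℤ) :
    twistBaseChange 𝒜 d (LinearMap.id : E →ₗ[ℂ] E) = 𝟙 _ := by
  refine twist_hom_ext fun U s => Subtype.ext <| funext fun x => ?_
  change LocalizedModule.map (complAt x.1) (LinearMap.baseChange A LinearMap.id) (s.1 x) = s.1 x
  rw [LinearMap.baseChange_id, LocalizedModule.map_id]
  rfl

theorem twistBaseChange_comp (d : ℤ) (f : E →ₗ[ℂ] E') (g : E' →ₗ[ℂ] E'') :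
    twistBaseChange 𝒜 d (g ∘ₗ f) = twistBaseChange 𝒜 d f ≫ twistBaseChange 𝒜 d g := by
  refine twist_hom_ext fun U s => Subtype.ext <| funext fun x => ?_
  change LocalizedModule.map (complAt x.1) (LinearMap.baseChange A (g ∘ₗ f)) (s.1 x) =
    LocalizedModule.map (complAt x.1) (g.baseChange A)
      (LocalizedModule.map (complAt x.1) (f.baseChange A) (s.1 x))
  rw [LinearMap.baseChange_comp]
  induction (s.1 x) using LocalizedModule.induction_on with
  | h n t => simp [LocalizedModule.map_mk]

end Sheaves

section GradedQuotient

variable {A : Type u} [CommRing A] [Algebra ℂ A] (𝒜 : ℕ → Submodule ℂ A) [GradedAlgebra 𝒜]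
variable (I : Ideal A)

/-- The grading on `A ⧸ I` given by the images of the homogeneous parts of `A`. -/
def quotientGrading (i : ℕ) : Submodule ℂ (A ⧸ I) :=
  (𝒜 i).map (Ideal.Quotient.mkₐ ℂ I).toLinearMap

variable {I} in
theorem quotientGrading_isInternal (hI : I.IsHomogeneous 𝒜) :
    DirectSum.IsInternal (quotientGrading 𝒜 I) := by
  let l (i : ℕ) : 𝒜 i →ₗ[ℂ] quotientGrading 𝒜 I i :=
    (Ideal.Quotient.mkₐ ℂ I).toLinearMap.submoduleMap (𝒜 i)
  have hl : Function.Surjective (DirectSum.lmap l) :=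
    (DirectSum.lmap_surjective _).2 fun i =>
      LinearMap.submoduleMap_surjective _ _
  have key (x) : DirectSum.coeAddMonoidHom (quotientGrading 𝒜 I) (DirectSum.lmap l x) =
      Ideal.Quotient.mk I (DirectSum.coeAddMonoidHom 𝒜 x) := by
    induction x using DirectSum.induction_on with
    | zero => simp
    | of i x =>
      have : DirectSum.lmap l (DirectSum.of (fun i => 𝒜 i) i x) =
        DirectSum.of (fun i => quotientGrading 𝒜 I i) i (l i x) := DirectSum.lmap_lof ..
      rw [this, DirectSum.coeAddMonoidHom_of, DirectSum.coeAddMonoidHom_of]; rfl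
    | add x y hx hy => simp only [map_add, hx, hy]
  constructor
  · rw [injective_iff_map_eq_zero]
    intro y hy
    obtain ⟨x, rfl⟩ := hl y
    rw [key, Ideal.Quotient.eq_zero_iff_mem] at hy
    ext i : 1
    have := hI i hy
    obtain ⟨a, rfl⟩ := (DirectSum.decompose 𝒜).surjective x
    rw [show DirectSum.coeAddMonoidHom 𝒜 (DirectSum.decompose 𝒜 a) = a from
      (DirectSum.decompose 𝒜).symm_apply_apply a] at this
    rw [DirectSum.lmap_apply]
    exact Subtype.ext (Ideal.Quotient.eq_zero_iff_mem.2 this)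
  · intro y
    obtain ⟨a, rfl⟩ := Ideal.Quotient.mk_surjective y
    exact ⟨DirectSum.lmap l (DirectSum.decompose 𝒜 a), (key _).trans
      congr(Ideal.Quotient.mk I $((DirectSum.decompose 𝒜).symm_apply_apply a))⟩

variable {I} in
theorem quotientGrading_gradedMonoid : SetLike.GradedMonoid (quotientGrading 𝒜 I) where
  one_mem := ⟨1, SetLike.one_mem_graded 𝒜, map_one (Ideal.Quotient.mkₐ ℂ I)⟩
  mul_mem := by
    rintro i j _ _ ⟨a, ha, rfl⟩ ⟨b, hb, rfl⟩
    exact ⟨a * b, SetLike.mul_mem_graded ha hb, map_mul (Ideal.Quotient.mkₐ ℂ I) a b⟩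

variable {I} in
/-- The quotient of a graded algebra by a homogeneous ideal is a graded algebra. -/
@[reducible]
def quotientGradedAlgebra (hI : I.IsHomogeneous 𝒜) : GradedAlgebra (quotientGrading 𝒜 I) where
  toGradedMonoid := quotientGrading_gradedMonoid 𝒜
  toDecomposition := (quotientGrading_isInternal 𝒜 hI).chooseDecomposition

end GradedQuotient

section Quadric

variable {V ι : Type u} [AddCommGroup V] [Module ℂ V] [Fintype ι] (b : Module.Basis ι ℂ V)
  (q : QuadraticForm ℂ V)

/-- The quadratic form `q` as a polynomial in the coordinates with respect to the basis `b`. -/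
def quadPoly : MvPolynomial ι ℂ :=
  ∑ i, ∑ j, MvPolynomial.C (QuadraticMap.associated (R := ℂ) q (b i) (b j)) *
    (MvPolynomial.X i * MvPolynomial.X j)

theorem eval_quadPoly (c : ι → ℂ) : MvPolynomial.eval c (quadPoly b q) = q (∑ i, c i • b i) := by
  rw [← QuadraticMap.associated_eq_self_apply ℂ q (∑ i, c i • b i)]
  simp only [quadPoly, map_sum, map_mul, MvPolynomial.eval_C, MvPolynomial.eval_X,
    LinearMap.sum_apply, map_smul, LinearMap.smul_apply, smul_eq_mul]
  refine Finset.sum_congr rfl fun i _ => ?_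
  rw [Finset.mul_sum]
  refine Finset.sum_congr rfl fun j _ => ?_
  rw [QuadraticMap.associated_isSymm ℂ q (b i) (b j)]
  ring

theorem quadPoly_isHomogeneous : (quadPoly b q).IsHomogeneous 2 :=
  MvPolynomial.IsHomogeneous.sum _ _ _ fun i _ => MvPolynomial.IsHomogeneous.sum _ _ _ fun j _ =>
    ((MvPolynomial.isHomogeneous_X ℂ i).mul (MvPolynomial.isHomogeneous_X ℂ j)).C_mul _

/-- The homogeneous coordinate ring `ℂ[x] / (q)` of the quadric. -/
abbrev coordRing : Type u := MvPolynomial ι ℂ ⧸ Ideal.span {quadPoly b q}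

/-- The grading of the homogeneous coordinate ring of the quadric by degree. -/
abbrev coordGrading : ℕ → Submodule ℂ (coordRing b q) :=
  quotientGrading (MvPolynomial.homogeneousSubmodule ι ℂ) (Ideal.span {quadPoly b q})

instance coordGradedAlgebra : GradedAlgebra (coordGrading b q) :=
  letI : GradedAlgebra (MvPolynomial.homogeneousSubmodule ι ℂ) := MvPolynomial.gradedAlgebra
  quotientGradedAlgebra _ <| Ideal.homogeneous_span _ _ <| by
    rintro _ rfl
    exact ⟨2, quadPoly_isHomogeneous b q⟩

/-- The quadric hypersurface `Q = {q = 0}` in the projective space of lines in `V`, as the scheme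
`Proj (ℂ[x] / (q))`. -/
abbrev quadric : Scheme.{u} := Proj (coordGrading b q)

/-- The `i`-th coordinate on `V`, as a linear form on the quadric. -/
def coordFn (i : ι) : coordRing b q := Ideal.Quotient.mk _ (MvPolynomial.X i)

theorem coord_mem (i : ι) : coordFn b q i ∈ coordGrading b q 1 :=
  ⟨MvPolynomial.X i, MvPolynomial.isHomogeneous_X ℂ i, rfl⟩

end Quadric

section CliffordModules

variable {V : Type u} [AddCommGroup V] [Module ℂ V]

/-- A `ℤ/2`-graded left module over the Clifford algebra of `q`. -/
structure GradedCliffordModule (q : QuadraticForm ℂ V) where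
  /-- the underlying type -/
  carrier : Type u
  [addCommGroup : AddCommGroup carrier]
  [module : Module ℂ carrier]
  [cliffordModule : Module (CliffordAlgebra q) carrier]
  [isScalarTower : IsScalarTower ℂ (CliffordAlgebra q) carrier]
  /-- the even part `grading 0` and the odd part `grading 1` -/
  grading : ZMod 2 → Submodule ℂ carrier
  isInternal : DirectSum.IsInternal grading
  smul_mem : ∀ {i j : ZMod 2} {a : CliffordAlgebra q} {m : carrier},
    a ∈ CliffordAlgebra.evenOdd q i → m ∈ grading j → a • m ∈ grading (i + j)

namespace GradedCliffordModule

attribute [instance] addCommGroup module cliffordModule isScalarTower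

variable {q : QuadraticForm ℂ V}

/-- The space of grading-preserving homomorphisms of Clifford modules. -/
def homs (M N : GradedCliffordModule q) :
    Submodule ℂ (M.carrier →ₗ[CliffordAlgebra q] N.carrier) where
  carrier := {f | ∀ i, ∀ m ∈ M.grading i, f m ∈ N.grading i}
  zero_mem' := fun i _ _ => zero_mem (N.grading i)
  add_mem' := fun hf hg i m hm => add_mem (hf i m hm) (hg i m hm)
  smul_mem' := fun c _ hf i m hm => (N.grading i).smul_mem c (hf i m hm)

instance : Category (GradedCliffordModule q) where
  Hom M N := homs M N
  id M := ⟨LinearMap.id, fun _ _ hm => hm⟩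
  comp f g := ⟨g.1 ∘ₗ f.1, fun i m hm => g.2 i _ (f.2 i m hm)⟩

instance (M N : GradedCliffordModule q) : AddCommGroup (M ⟶ N) :=
  inferInstanceAs (AddCommGroup (homs M N))

instance (M N : GradedCliffordModule q) : Module ℂ (M ⟶ N) :=
  inferInstanceAs (Module ℂ (homs M N))

/-- The degree `i` part of a homomorphism of graded Clifford modules. -/
def homPart {M N : GradedCliffordModule q} (f : M ⟶ N) (i : ZMod 2) :
    M.grading i →ₗ[ℂ] N.grading i :=
  (f.1.restrictScalars ℂ).restrict (f.2 i)

/-- Multiplication by a vector, from the even part to the odd part. -/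
def act (M : GradedCliffordModule q) (v : V) : M.grading 0 →ₗ[ℂ] M.grading 1 :=
  (Module.toModuleEnd ℂ (S := CliffordAlgebra q) M.carrier (CliffordAlgebra.ι q v)).restrict
    fun _ hm => M.smul_mem (CliffordAlgebra.ι_mem_evenOdd_one q v) hm

end GradedCliffordModule

variable (q : QuadraticForm ℂ V)

/-- The left ideal `Cl · w₁ ⋯ wₘ` of the Clifford algebra. -/
def leftIdeal {m : ℕ} (w : Fin m → V) : Ideal (CliffordAlgebra q) :=
  Ideal.span {(List.ofFn fun i => CliffordAlgebra.ι q (w i)).prod}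

theorem leftIdeal_isHomogeneous {m : ℕ} (w : Fin m → V) :
    (leftIdeal q w).IsHomogeneous (CliffordAlgebra.evenOdd q) := by
  refine Ideal.homogeneous_span _ _ ?_
  rintro _ rfl
  exact ⟨_, SetLike.list_prod_ofFn_mem_graded (fun _ => 1) _ fun i =>
    CliffordAlgebra.ι_mem_evenOdd_one q (w i)⟩

/-- The grading on a left ideal `I` by `I ∩ Cl_ev` and `I ∩ Cl_odd`. -/
def idealGrading (I : Ideal (CliffordAlgebra q)) (i : ZMod 2) : Submodule ℂ I :=
  (CliffordAlgebra.evenOdd q i).comap (I.subtype.restrictScalars ℂ)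

variable {q} in
theorem idealGrading_isInternal {I : Ideal (CliffordAlgebra q)}
    (hI : I.IsHomogeneous (CliffordAlgebra.evenOdd q)) :
    DirectSum.IsInternal (idealGrading q I) := by
  let l (i : ZMod 2) : idealGrading q I i →ₗ[ℂ] CliffordAlgebra.evenOdd q i :=
    (I.subtype.restrictScalars ℂ).restrict fun _ hx => hx
  have hl : Function.Injective (DirectSum.lmap l) :=
    (DirectSum.lmap_injective _).2 fun i x y hxy =>
      Subtype.ext (Subtype.ext congr(($hxy : CliffordAlgebra q)))
  have key (x) : DirectSum.coeAddMonoidHom (CliffordAlgebra.evenOdd q) (DirectSum.lmap l x) =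
      (DirectSum.coeAddMonoidHom (idealGrading q I) x : I) := by
    induction x using DirectSum.induction_on with
    | zero => simp
    | of i x =>
      have : DirectSum.lmap l (DirectSum.of (fun i => idealGrading q I i) i x) =
        DirectSum.of (fun i => CliffordAlgebra.evenOdd q i) i (l i x) := DirectSum.lmap_lof ..
      rw [this, DirectSum.coeAddMonoidHom_of, DirectSum.coeAddMonoidHom_of]; rfl
    | add x y hx hy => simp only [map_add, hx, hy, Submodule.coe_add]
  constructor
  · intro x y hxy
    refine hl ((DirectSum.decompose (CliffordAlgebra.evenOdd q)).symm.injective ?_)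
    exact (key x).trans (congr(($hxy : CliffordAlgebra q)).trans (key y).symm)
  · intro y
    refine ⟨∑ i, DirectSum.of (fun i => idealGrading q I i) i
      ⟨⟨DirectSum.decompose (CliffordAlgebra.evenOdd q) y.1 i, hI i y.2⟩,
        (DirectSum.decompose (CliffordAlgebra.evenOdd q) y.1 i).2⟩, Subtype.ext ?_⟩
    rw [map_sum, AddSubmonoidClass.coe_finsetSum]
    simp only [DirectSum.coeAddMonoidHom_of]
    have := congr((DirectSum.decompose (CliffordAlgebra.evenOdd q)).symm
      $(DirectSum.sum_univ_of (DirectSum.decompose (CliffordAlgebra.evenOdd q) y.1)))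
    simpa only [DirectSum.decompose_symm_sum, DirectSum.decompose_symm_of,
      Equiv.symm_apply_apply] using this

/-- The left ideal `Cl · w₁ ⋯ wₘ` as a graded Clifford module. -/
def idealModule {m : ℕ} (w : Fin m → V) : GradedCliffordModule q where
  carrier := leftIdeal q w
  grading := idealGrading q (leftIdeal q w)
  isInternal := idealGrading_isInternal (leftIdeal_isHomogeneous q w)
  smul_mem := fun {_ _ _ _} ha hm => SetLike.mul_mem_graded ha hm

end CliffordModules

section Spinor

open GradedCliffordModule Limits

variable {V ι : Type u} [AddCommGroup V] [Module ℂ V] [Fintype ι] (b : Module.Basis ι ℂ V)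
  (q : QuadraticForm ℂ V)

variable {q} in
/-- The map `r ⊗ ξ ↦ ∑ xᵢ r ⊗ bᵢ ξ` of modules over the coordinate ring; here `∑ xᵢ ⊗ bᵢ` is the
tautological element of `V* ⊗ V`. -/
def phiLin (M : GradedCliffordModule q) :
    coordRing b q ⊗[ℂ] M.grading 0 →ₗ[coordRing b q] coordRing b q ⊗[ℂ] M.grading 1 :=
  ∑ i, coordFn b q i • (M.act (b i)).baseChange (coordRing b q)

variable {q} in
theorem phiLin_mem (M : GradedCliffordModule q) (i : ℕ) (n : coordRing b q ⊗[ℂ] M.grading 0)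
    (hn : n ∈ tensorDegree (coordGrading b q) (M.grading 0) i) :
    phiLin b M n ∈ tensorDegree (coordGrading b q) (M.grading 1) (i + 1) := by
  rw [phiLin, LinearMap.sum_apply]
  refine sum_mem fun k _ => ?_
  rw [add_comm]
  exact smul_mem_tensorDegree (coord_mem b q k) (baseChange_mem_tensorDegree _ _ _ hn)

variable {q} in
/-- The map `φ : 𝒪(-1) ⊗ M_ev ⟶ 𝒪 ⊗ M_odd`, `v ⊗ ξ ↦ 1 ⊗ v ξ`, restricted to the quadric. Here a
section `f` of `𝒪(-1)` is the section `v = ∑ (xᵢ f) ⊗ bᵢ` of the tautological line subbundle of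
`𝒪 ⊗ V`. -/
def phi (M : GradedCliffordModule q) :
    twist (coordGrading b q) (M.grading 0) (-1) ⟶ twist (coordGrading b q) (M.grading 1) 0 :=
  twistMap (phiLin b M) (m := 1) (by simp) (phiLin_mem b M)

variable {q} in
theorem phi_naturality {M N : GradedCliffordModule q} (f : M ⟶ N) :
    phi b M ≫ twistBaseChange _ 0 (homPart f 1) = twistBaseChange _ (-1) (homPart f 0) ≫ phi b N := by
  refine twist_hom_ext fun U s => Subtype.ext <| funext fun x => ?_
  change LocalizedModule.map (complAt x.1) ((homPart f 1).baseChange _)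
      (LocalizedModule.map (complAt x.1) (phiLin b M) (s.1 x)) =
    LocalizedModule.map (complAt x.1) (phiLin b N)
      (LocalizedModule.map (complAt x.1) ((homPart f 0).baseChange _) (s.1 x))
  have key (n) : (homPart f 1).baseChange (coordRing b q) (phiLin b M n) =
      phiLin b N ((homPart f 0).baseChange (coordRing b q) n) := by
    induction n with
    | zero => simp
    | add x y hx hy => simp only [map_add, hx, hy]
    | tmul r e =>
      simp only [phiLin, LinearMap.sum_apply, LinearMap.smul_apply, map_sum, map_smul,
        LinearMap.baseChange_tmul]
      refine Finset.sum_congr rfl fun i _ => ?_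
      congr 2
      exact Subtype.ext (f.1.map_smul _ _)
  induction (s.1 x) using LocalizedModule.induction_on with
  | h n t => simp only [LocalizedModule.map_mk, key]

/-- The functor sending a graded Clifford module `M` to its spinor sheaf, the cokernel of
`φ : 𝒪(-1) ⊗ M_ev ⟶ 𝒪 ⊗ M_odd`, a sheaf of modules on the quadric. On projective space `φ` has
image containing `q · (𝒪(-2) ⊗ M_odd)`, so that its cokernel there is annihilated by `q`; by right
exactness of restriction, that cokernel, seen as a sheaf on the quadric, is the one taken here. -/
def spinorSheaf : GradedCliffordModule q ⥤ (quadric b q).Modules where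
  obj M := cokernel (phi b M)
  map f := cokernel.map _ _ _ _ (phi_naturality b f)
  map_id M := by
    rw [← cancel_epi (cokernel.π (phi b M)), cokernel.π_desc, Category.comp_id]
    exact congr($(twistBaseChange_id 0) ≫ _).trans (Category.id_comp _)
  map_comp {L M N} f g := by
    rw [← cancel_epi (cokernel.π (phi b L)), cokernel.π_desc, cokernel.π_desc_assoc,
      Category.assoc, cokernel.π_desc, ← Category.assoc]
    exact congr($(twistBaseChange_comp 0 (homPart f 1) (homPart g 1)) ≫ _)

end Spinor

end SpinorSheaf

end

open SpinorSheaf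

set_option linter.unusedSectionVars false

/-! Write `A = ℂ[x]/(q)`. Multiplication by the tautological vector gives maps `φ : 𝒪(-1) ⊗ M_ev → 𝒪
⊗ M_odd`, `ψ : 𝒪 ⊗ M_odd → 𝒪(1) ⊗ M_ev` and `φ(1) : 𝒪(1) ⊗ M_ev → 𝒪(2) ⊗ M_odd`. By the Clifford
relation they form a matrix factorization: over the polynomial ring both composites are
multiplication by `q`. Since `q ≠ 0` is not a zero divisor there, the resulting complex over `A` is
exact (`IsCliffordPair.exists_eq`). Hence `S = coker φ` embeds through `ψ` into `𝒪(1) ⊗ M_ev`, with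
image killed by `φ(1)` (`mono_spinorInclusion`).

Given `g : S → S'`, consider `G : 𝒪 ⊗ M_odd → S → S' → 𝒪(1) ⊗ N_ev`. It is determined by the images
of the global sections `1 ⊗ e`. These are global sections of `𝒪(1) ⊗ N_ev`, hence elements of `A₁ ⊗
N_ev` (`IsDeterminingFamily.exists_eq_toLocAt`). They are killed by `φ`, so by exactness each is
`ψ(1 ⊗ e')` for a unique `e'`. This gives a linear map `f₁ : M_odd → N_odd` with `G = ψ ∘ (1 ⊗ f₁)`.
As `G` kills the image of `φ`, exactness at the other spot gives for each even `m` an `m'` with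
`f₁(v m) = v m'` for all `v` (`exists_even_part`); this defines `f₀`. Vectors with `q(v) ≠ 0` act
invertibly, so `f₀` is linear and `(f₀, f₁)` is Clifford linear (`exists_hom`). Faithfulness follows
from the uniqueness of `e'` and the same invertibility.

The geometric input is `H⁰(Q, 𝒪(1)) = A₁`, proved directly from `dim V ≥ 2`, for every nonzero `q`
however degenerate. Choose `e` with `q(e) ≠ 0` and let `z` be its coordinate in a basis containing
`e`. Then `A` is free with basis `1, z` over the polynomial ring `P` in the other coordinates. These
coordinates are nonzerodivisors without a common zero on `Q`, and divisibility by their powers can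
be tested in `P` (`isDeterminingFamily`). -/

namespace SpinorSheaf

/-! ### Homogeneous elements of `A ⊗ E` and their vanishing on open subsets of `Proj`. -/

section GradedTensor

variable {A : Type u} [CommRing A] [Algebra ℂ A] (𝒜 : ℕ → Submodule ℂ A) [GradedAlgebra 𝒜]
variable (E : Type u) [AddCommGroup E] [Module ℂ E]

/-- The projection of `A ⊗ E` to its degree `i` part. -/
noncomputable def tensorProj (i : ℕ) : A ⊗[ℂ] E →ₗ[ℂ] A ⊗[ℂ] E :=
  (GradedAlgebra.proj 𝒜 i).rTensor E

variable {E}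

theorem tensorProj_mem (i : ℕ) (n : A ⊗[ℂ] E) : tensorProj 𝒜 E i n ∈ tensorDegree 𝒜 E i := by
  induction n with
  | zero => simp
  | add x y hx hy => rw [map_add]; exact add_mem hx hy
  | tmul a e => exact ⟨DirectSum.decompose 𝒜 a i ⊗ₜ e, rfl⟩

variable {𝒜}

theorem tmul_mem_tensorDegree {i : ℕ} {a : A} (ha : a ∈ 𝒜 i) (e : E) :
    a ⊗ₜ e ∈ tensorDegree 𝒜 E i :=
  ⟨(⟨a, ha⟩ : 𝒜 i) ⊗ₜ e, rfl⟩

theorem tensorDegree_induction {i : ℕ} {p : A ⊗[ℂ] E → Prop} (zero : p 0)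
    (tmul : ∀ a ∈ 𝒜 i, ∀ e, p (a ⊗ₜ e))
    (add : ∀ x ∈ tensorDegree 𝒜 E i, ∀ y ∈ tensorDegree 𝒜 E i, p x → p y → p (x + y))
    {n : A ⊗[ℂ] E} (hn : n ∈ tensorDegree 𝒜 E i) : p n := by
  obtain ⟨t, rfl⟩ := hn
  induction t with
  | zero => simpa using zero
  | add x y hx hy => rw [map_add]; exact add _ ⟨x, rfl⟩ _ ⟨y, rfl⟩ hx hy
  | tmul a e => exact tmul _ a.2 e

theorem proj_mul_left {i : ℕ} {a : A} (ha : a ∈ 𝒜 i) (j : ℕ) (x : A) :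
    GradedAlgebra.proj 𝒜 (i + j) (a * x) = a * GradedAlgebra.proj 𝒜 j x := by
  simp only [GradedAlgebra.proj_apply]
  exact DirectSum.coe_decompose_mul_add_of_left_mem 𝒜 ha

theorem proj_mul_left_of_lt {i k : ℕ} {a : A} (ha : a ∈ 𝒜 i) (hk : k < i) (x : A) :
    GradedAlgebra.proj 𝒜 k (a * x) = 0 := by
  simp only [GradedAlgebra.proj_apply]
  exact DirectSum.coe_decompose_mul_of_left_mem_of_not_le 𝒜 ha (by omega)

theorem tensorProj_smul {i : ℕ} {a : A} (ha : a ∈ 𝒜 i) (j : ℕ) (n : A ⊗[ℂ] E) :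
    tensorProj 𝒜 E (i + j) (a • n) = a • tensorProj 𝒜 E j n := by
  induction n with
  | zero => simp
  | add x y hx hy => simp only [smul_add, map_add, hx, hy]
  | tmul r e => simp [tensorProj, TensorProduct.smul_tmul', proj_mul_left ha]

theorem tensorProj_smul_of_lt {i k : ℕ} {a : A} (ha : a ∈ 𝒜 i) (hk : k < i) (n : A ⊗[ℂ] E) :
    tensorProj 𝒜 E k (a • n) = 0 := by
  induction n with
  | zero => simp
  | add x y hx hy => simp only [smul_add, map_add, hx, hy, add_zero]
  | tmul r e => simp [tensorProj, TensorProduct.smul_tmul', proj_mul_left_of_lt ha hk]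

theorem tensorProj_of_mem {i : ℕ} {n : A ⊗[ℂ] E} (hn : n ∈ tensorDegree 𝒜 E i) :
    tensorProj 𝒜 E i n = n := by
  refine tensorDegree_induction (p := fun n => tensorProj 𝒜 E i n = n) (by simp) ?_ ?_ hn
  · intro a ha e
    simp [tensorProj, GradedAlgebra.proj_apply, DirectSum.decompose_of_mem_same 𝒜 ha]
  · intro x _ y _ h h'
    rw [map_add, h, h']

/-- This is what makes the annihilator of a homogeneous element a homogeneous ideal. -/
theorem tensorProj_smul_of_mem {j : ℕ} {n : A ⊗[ℂ] E} (hn : n ∈ tensorDegree 𝒜 E j) (i : ℕ)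
    (a : A) : tensorProj 𝒜 E (i + j) (a • n) = GradedAlgebra.proj 𝒜 i a • n := by
  refine tensorDegree_induction
    (p := fun n => tensorProj 𝒜 E (i + j) (a • n) = GradedAlgebra.proj 𝒜 i a • n) (by simp)
    (fun r hr e => ?_) (fun x _ y _ h h' => ?_) hn
  · simp only [tensorProj, TensorProduct.smul_tmul', LinearMap.rTensor_tmul, smul_eq_mul]
    rw [mul_comm a r, add_comm, proj_mul_left hr, mul_comm]
  · rw [smul_add, smul_add, map_add, h, h']

/-- An element of positive degree that vanishes on the zero locus of a homogeneous ideal in the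
projective spectrum lies in the radical of the ideal. -/
theorem mem_radical_of_forall_mem {I : Ideal A} (hI : I.IsHomogeneous 𝒜) {t : A} {k : ℕ}
    (ht : t ∈ 𝒜 k) (hk : 0 < k)
    (h : ∀ x : ProjectiveSpectrum 𝒜, I ≤ x.asHomogeneousIdeal.toIdeal →
      t ∈ x.asHomogeneousIdeal.toIdeal) : t ∈ I.radical := by
  rw [hI.radical_eq, Ideal.mem_sInf]
  rintro J ⟨hJ, hIJ, hJp⟩
  by_contra htJ
  -- The radical is an intersection of homogeneous primes. One that omits `t` cannot contain the
  -- irrelevant ideal, because `t` has positive degree; so it is a point of `Proj`.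
  refine htJ (h ⟨⟨J, hJ⟩, hJp, fun hle => htJ (hle ?_)⟩ hIJ)
  rw [HomogeneousIdeal.mem_irrelevant_iff, GradedRing.proj_apply]
  exact DirectSum.decompose_of_mem_ne 𝒜 ht hk.ne'

/-- The image of `n` in the localization at `x`. -/
noncomputable abbrev toLocAt (x : ProjectiveSpectrum 𝒜) : A ⊗[ℂ] E →ₗ[A] LocAt 𝒜 E x :=
  LocalizedModule.mkLinearMap (complAt x) (A ⊗[ℂ] E)

theorem toLocAt_eq_zero_iff {x : ProjectiveSpectrum 𝒜} {n : A ⊗[ℂ] E} :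
    toLocAt x n = 0 ↔ ∃ s ∈ complAt x, s • n = 0 := by
  rw [IsLocalizedModule.eq_zero_iff (complAt x)]
  exact ⟨fun ⟨c, hc⟩ => ⟨c, c.2, hc⟩, fun ⟨s, hs, h⟩ => ⟨⟨s, hs⟩, h⟩⟩

theorem smul_eq_toLocAt_iff {x : ProjectiveSpectrum 𝒜} {n : A ⊗[ℂ] E} {s : A}
    (hs : s ∈ complAt x) {f : LocAt 𝒜 E x} :
    s • f = toLocAt x n ↔ f = LocalizedModule.mk n ⟨s, hs⟩ := by
  rw [IsLocalizedModule.mk_eq_mk', eq_comm (a := f),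
    IsLocalizedModule.mk'_eq_iff, eq_comm]
  rfl

theorem smul_right_injective_locAt {x : ProjectiveSpectrum 𝒜} {s : A} (hs : s ∈ complAt x)
    {f g : LocAt 𝒜 E x} (h : s • f = s • g) : f = g :=
  IsLocalizedModule.smul_injective (toLocAt x) (⟨s, hs⟩ : complAt x) h

/-- A homogeneous element of `A ⊗ E` that vanishes on `D(t)` is killed by a power of `t`. -/
theorem exists_pow_smul_eq_zero {i k : ℕ} {n : A ⊗[ℂ] E} (hn : n ∈ tensorDegree 𝒜 E i) {t : A}
    (ht : t ∈ 𝒜 k) (hk : 0 < k)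
    (h : ∀ x : ProjectiveSpectrum 𝒜, t ∈ complAt x → toLocAt x n = 0) :
    ∃ N : ℕ, t ^ N • n = 0 := by
  -- The kernel is the annihilator of `n`. Vanishing of `n` at a point means that the annihilator is
  -- not contained in the corresponding prime.
  have hI : (LinearMap.ker (LinearMap.toSpanSingleton A _ n)).IsHomogeneous 𝒜 := by
    intro j a ha
    have ha' : a • n = 0 := ha
    have := tensorProj_smul_of_mem hn j a
    rw [ha', map_zero] at this
    exact this.symm
  obtain ⟨N, hN⟩ := mem_radical_of_forall_mem hI ht hk fun x hx => by
    by_contra htx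
    obtain ⟨s, hs, hsn⟩ := toLocAt_eq_zero_iff.1 (h x htx)
    exact hs (hx hsn)
  exact ⟨N, hN⟩

end GradedTensor

/-! ### Sections over `D(y)` for a form `y` of degree one. -/

section Fractions

variable {A : Type u} [CommRing A] [Algebra ℂ A] {𝒜 : ℕ → Submodule ℂ A} [GradedAlgebra 𝒜]
variable {E : Type u} [AddCommGroup E] [Module ℂ E]

theorem exists_homogeneous_basicOpen_le {V : Opens (ProjectiveSpectrum 𝒜)}
    {x : ProjectiveSpectrum 𝒜} (hx : x ∈ V) :
    ∃ (k : ℕ) (t : A), 0 < k ∧ t ∈ 𝒜 k ∧ t ∈ complAt x ∧ ProjectiveSpectrum.basicOpen 𝒜 t ≤ V := by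
  obtain ⟨_, ⟨r, rfl⟩, hxr, hr⟩ :=
    (ProjectiveSpectrum.isTopologicalBasis_basic_opens 𝒜).exists_subset_of_mem_open hx V.2
  have hxr' : x ∈ ProjectiveSpectrum.basicOpen 𝒜 r := hxr
  rw [ProjectiveSpectrum.basicOpen_eq_union_of_projection, Opens.mem_iSup] at hxr'
  obtain ⟨i, hi⟩ := hxr'
  obtain ⟨j, s, hj, hs, hsx⟩ := exists_mem_compl x 1
  refine ⟨j + i, s * GradedRing.proj 𝒜 i r, by omega,
    SetLike.mul_mem_graded hs (DirectSum.decompose 𝒜 r i).2, mul_mem hsx hi, ?_⟩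
  refine (ProjectiveSpectrum.basicOpen_mul_le_right 𝒜 _ _).trans (le_trans (fun y hy => ?_) hr)
  rw [ProjectiveSpectrum.basicOpen_eq_union_of_projection, Opens.mem_iSup]
  exact ⟨i, hy⟩

/-- Near a point, a section is a fraction on the open set where its denominator is invertible. -/
theorem exists_local_fraction {d : ℤ} {U V : Opens (ProjectiveSpectrum 𝒜)}
    (σ : twistSections 𝒜 E d U) (hVU : V ≤ U) {x : ProjectiveSpectrum 𝒜} (hx : x ∈ V) :
    ∃ (k i : ℕ) (t : A) (n : A ⊗[ℂ] E) (hV : ProjectiveSpectrum.basicOpen 𝒜 t ≤ V),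
      0 < k ∧ (i : ℤ) = k + d ∧ t ∈ 𝒜 k ∧ n ∈ tensorDegree 𝒜 E i ∧ t ∈ complAt x ∧
      ∀ y (hy : y ∈ ProjectiveSpectrum.basicOpen 𝒜 t),
        t • σ.1 ⟨y, hVU (hV hy)⟩ = toLocAt y n := by
  obtain ⟨W, mW, iW, i, j, n, s, h, hn, hs, w⟩ := σ.2 ⟨x, hVU hx⟩
  -- Expanding the fraction by `r` makes the nonvanishing locus of the new denominator `r * s` lie
  -- inside the neighbourhood, and its degree positive.
  obtain ⟨k, r, hk, hr, hrx, hle⟩ := exists_homogeneous_basicOpen_le (V := V ⊓ W) ⟨hx, mW⟩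
  have hle' := (ProjectiveSpectrum.basicOpen_mul_le_left 𝒜 r s).trans hle
  refine ⟨k + j, k + i, r * s, r • n, hle'.trans inf_le_left, by omega, by push_cast; omega,
    SetLike.mul_mem_graded hr hs, smul_mem_tensorDegree hr hn, mul_mem hrx (w ⟨x, mW⟩).1,
    fun y hy => ?_⟩
  obtain ⟨h1, e1⟩ := w ⟨y, (hle' hy).2⟩
  rw [mul_smul, map_smul]
  congr 1
  exact (smul_eq_toLocAt_iff h1).2 e1

/-- On the open set where a form `y` of degree one is invertible, a section is a single fraction
whose denominator is a power of `y`. -/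
theorem exists_fraction_of_basicOpen_le {d : ℤ} {U : Opens (ProjectiveSpectrum 𝒜)}
    (σ : twistSections 𝒜 E d U) {y : A} (hy : y ∈ 𝒜 1)
    (hU : ProjectiveSpectrum.basicOpen 𝒜 y ≤ U) :
    ∃ (N i : ℕ) (n : A ⊗[ℂ] E), (i : ℤ) = N + d ∧ n ∈ tensorDegree 𝒜 E i ∧
      ∀ x (hx : x ∈ ProjectiveSpectrum.basicOpen 𝒜 y), y ^ N • σ.1 ⟨x, hU hx⟩ = toLocAt x n := by
  classical
  choose k i t n hV hk hi ht hn htx e using fun x : ProjectiveSpectrum.basicOpen 𝒜 y =>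
    exists_local_fraction σ hU x.2
  have hom {f : ProjectiveSpectrum.basicOpen 𝒜 y → A} {m : ProjectiveSpectrum.basicOpen 𝒜 y → ℕ}
      (S : Set (ProjectiveSpectrum.basicOpen 𝒜 y)) (hf : ∀ x, f x ∈ 𝒜 (m x)) :
      (Ideal.span (f '' S)).IsHomogeneous 𝒜 := by
    refine Ideal.homogeneous_span _ _ ?_
    rintro _ ⟨x, _, rfl⟩
    exact ⟨m x, hf x⟩
  -- Quasi-compactness of `D(y)`: the sets `D(t x)` cover it, so a power of `y` lies in the ideal of
  -- all the `t x`, and hence in that of finitely many.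
  obtain ⟨N₀, hN₀⟩ : y ∈ (Ideal.span (t '' Set.univ)).radical := by
    refine mem_radical_of_forall_mem (hom _ ht) hy one_pos fun x hx => ?_
    by_contra hxy
    exact htx ⟨x, hxy⟩ (hx (Ideal.subset_span ⟨_, trivial, rfl⟩))
  obtain ⟨F, hF⟩ : ∃ F : Finset (ProjectiveSpectrum.basicOpen 𝒜 y),
      y ^ N₀ ∈ Ideal.span (t '' (F : Set _)) := by
    obtain ⟨T, hT, hyT⟩ := Submodule.mem_span_finite_of_mem_span hN₀
    obtain ⟨F, -, rfl⟩ := Finset.subset_set_image_iff.1 hT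
    exact ⟨F, by simpa using hyT⟩
  have hcov (x : ProjectiveSpectrum 𝒜) (hx : y ∈ complAt x) : ∃ z ∈ F, t z ∈ complAt x := by
    by_contra! h
    refine hx (x.2.mem_of_pow_mem N₀ (Ideal.span_le.2 ?_ hF))
    rintro _ ⟨z, hz, rfl⟩
    exact not_not.1 (h z hz)
  have compat (z z' : ProjectiveSpectrum.basicOpen 𝒜 y) :
      ∃ K : ℕ, (t z * t z') ^ K • (t z' • n z - t z • n z') = 0 := by
    have hz : t z' • n z ∈ tensorDegree 𝒜 E (k z' + i z) := smul_mem_tensorDegree (ht z') (hn z)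
    have hz' : t z • n z' ∈ tensorDegree 𝒜 E (k z' + i z) := by
      rw [show k z' + i z = k z + i z' by have := hi z; have := hi z'; omega]
      exact smul_mem_tensorDegree (ht z) (hn z')
    refine exists_pow_smul_eq_zero (sub_mem hz hz') (SetLike.mul_mem_graded (ht z) (ht z'))
      (by have := hk z; omega) fun x hx => ?_
    have h1 : t z ∈ complAt x := fun h => hx (Ideal.mul_mem_right _ _ h)
    have h2 : t z' ∈ complAt x := fun h => hx (Ideal.mul_mem_left _ _ h)
    rw [map_sub, map_smul, map_smul, ← e z x h1, ← e z' x h2, smul_comm, sub_self]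
  choose K hK using compat
  -- A common exponent for the finitely many pairs. Rewriting `n z / t z` as `t z ^ m • n z / t z ^
  -- (m + 1)` makes the fractions agree by cross-multiplication in `A ⊗ E` itself.
  let m := (F ×ˢ F).sup fun p => K p.1 p.2
  have hm (z) (hz : z ∈ F) (z') (hz' : z' ∈ F) :
      t z' ^ (m + 1) • (t z ^ m • n z) = t z ^ (m + 1) • (t z' ^ m • n z') := by
    have hle : K z z' ≤ m :=
      Finset.le_sup (f := fun p : _ × _ => K p.1 p.2) (Finset.mk_mem_product hz hz')
    have := congr((t z * t z') ^ (m - K z z') • $(hK z z'))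
    rw [smul_zero, ← mul_smul, ← pow_add, Nat.sub_add_cancel hle, smul_sub, sub_eq_zero,
      smul_smul, smul_smul] at this
    rw [smul_smul, smul_smul]
    convert this using 2 <;> ring
  have htm (z) : t z ^ (m + 1) ∈ 𝒜 ((m + 1) * k z) := SetLike.pow_mem_graded (m + 1) (ht z)
  have hnm (z) : t z ^ m • n z ∈ tensorDegree 𝒜 E (m * k z + i z) :=
    smul_mem_tensorDegree (SetLike.pow_mem_graded m (ht z)) (hn z)
  obtain ⟨N, hN⟩ : y ∈ (Ideal.span ((fun z => t z ^ (m + 1)) '' (F : Set _))).radical := by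
    refine mem_radical_of_forall_mem (hom _ htm) hy one_pos fun x hx => ?_
    by_contra hxy
    obtain ⟨z, hz, hzx⟩ := hcov x hxy
    exact hzx (x.2.mem_of_pow_mem _ (hx (Ideal.subset_span ⟨z, hz, rfl⟩)))
  -- The first summand bounds the degrees of the `t z ^ (m + 1)`, so that homogeneous coefficients
  -- exist; the second makes `N + M + d` nonnegative.
  let M := (F.sup fun z => (m + 1) * k z) + (-d).toNat
  replace hN : y ^ (N + M) ∈ Ideal.span ((fun z => t z ^ (m + 1)) '' (F : Set _)) := by
    rw [pow_add]; exact Ideal.mul_mem_right _ _ hN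
  obtain ⟨a, ha⟩ : ∃ a : _ → A, ∑ z ∈ F, a z * t z ^ (m + 1) = y ^ (N + M) := by
    obtain ⟨a, ha⟩ := (Submodule.mem_span_image_finset_iff_exists_fun A).1 hN
    refine ⟨fun z => if h : z ∈ F then a ⟨z, h⟩ else 0, ?_⟩
    rw [← ha, ← Finset.sum_coe_sort]
    exact Finset.sum_congr rfl fun z _ => by simp
  have hyM : y ^ (N + M) ∈ 𝒜 (N + M) := by
    simpa using SetLike.pow_mem_graded (N + M) hy
  have hkM (z) (hz : z ∈ F) : (m + 1) * k z ≤ N + M :=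
    (Finset.le_sup (f := fun z => (m + 1) * k z) hz).trans (by omega)
  -- Only the homogeneous parts of the coefficients contribute to the form `y ^ (N + M)`. The glued
  -- numerator is then `∑ a' z • t z ^ m • n z`.
  let a' (z) := GradedAlgebra.proj 𝒜 (N + M - (m + 1) * k z) (a z)
  have ha' : ∑ z ∈ F, a' z * t z ^ (m + 1) = y ^ (N + M) := by
    have := congr(GradedAlgebra.proj 𝒜 (N + M) $ha)
    rw [GradedAlgebra.proj_apply 𝒜 _ (y ^ _), DirectSum.decompose_of_mem_same 𝒜 hyM] at this
    rw [← this, map_sum]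
    refine Finset.sum_congr rfl fun z hz => ?_
    rw [mul_comm (a z)]
    conv_rhs => rw [show N + M = (m + 1) * k z + (N + M - (m + 1) * k z) by
      have := hkM z hz; omega]
    rw [proj_mul_left (htm z), mul_comm]
  refine ⟨N + M, (N + M + d).toNat, ∑ z ∈ F, a' z • (t z ^ m • n z), by omega,
    sum_mem fun z hz => ?_, fun x hx => ?_⟩
  · have h1 := hkM z hz
    have h2 := hi z
    rw [show (N + M + d).toNat = (N + M - (m + 1) * k z) + (m * k z + i z) by
      zify [h1]; rw [Int.toNat_of_nonneg (by omega), h2]; ring]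
    exact smul_mem_tensorDegree (DirectSum.decompose 𝒜 (a z) _).2 (hnm z)
  · obtain ⟨z', hz', hzx⟩ := hcov x hx
    refine smul_right_injective_locAt (pow_mem hzx (m + 1)) ?_
    rw [smul_comm, pow_succ, mul_smul, e z' x hzx, ← map_smul, ← map_smul, ← map_smul, ← ha',
      Finset.sum_smul, Finset.smul_sum]
    congr 1
    refine Finset.sum_congr rfl fun z hz => ?_
    rw [smul_comm _ (a' z), ← pow_succ, hm z hz z' hz', mul_smul]

end Fractions

/-! ### Global sections of `𝒪(1) ⊗ E`. -/

section GlobalSections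

variable {A : Type u} [CommRing A] [Algebra ℂ A] {𝒜 : ℕ → Submodule ℂ A} [GradedAlgebra 𝒜]
variable {E : Type u} [AddCommGroup E] [Module ℂ E]

/-- `A ⊗ E` is free over `A`, so nonzerodivisors of `A` act injectively on it. -/
theorem smul_injective_tensor {y : A} (hy : ∀ a, y * a = 0 → a = 0) {n : A ⊗[ℂ] E}
    (h : y • n = 0) : n = 0 := by
  let B := Algebra.TensorProduct.basis A (Module.Basis.ofVectorSpace ℂ E)
  refine B.repr.injective (Finsupp.ext fun k => ?_)
  have := congr(B.repr $h k)
  rw [map_smul, Finsupp.smul_apply, map_zero] at this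
  simpa using hy _ this

theorem smul_left_cancel_tensor {y : A} (hy : ∀ a, y * a = 0 → a = 0) {n m : A ⊗[ℂ] E}
    (h : y • n = y • m) : n = m :=
  sub_eq_zero.1 (smul_injective_tensor hy (by rw [smul_sub, h, sub_self]))

theorem repr_mem_of_mem_tensorDegree {i : ℕ} {n : A ⊗[ℂ] E} (hn : n ∈ tensorDegree 𝒜 E i)
    {K : Type*} (B : Module.Basis K ℂ E) (k : K) :
    (Algebra.TensorProduct.basis A B).repr n k ∈ 𝒜 i := by
  refine tensorDegree_induction
    (p := fun n => (Algebra.TensorProduct.basis A B).repr n k ∈ 𝒜 i) ?_ ?_ ?_ hn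
  · simp
  · intro a ha e
    have : (B.repr e k) • a ∈ 𝒜 i := (𝒜 i).smul_mem _ ha
    simpa [Algebra.TensorProduct.basis_repr_tmul, Algebra.smul_def, mul_comm] using this
  · intro x _ y _ hx hy
    simpa using add_mem hx hy

theorem exists_smul_eq_of_repr {K : Type*} (B : Module.Basis K A (A ⊗[ℂ] E)) {y : A}
    {n : A ⊗[ℂ] E} (h : ∀ k, y ∣ B.repr n k) : ∃ m, n = y • m := by
  choose c hc using h
  refine ⟨∑ k ∈ (B.repr n).support, c k • B k, ?_⟩
  conv_lhs => rw [← B.linearCombination_repr n]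
  rw [Finsupp.linearCombination_apply, Finsupp.sum, Finset.smul_sum]
  exact Finset.sum_congr rfl fun k _ => by rw [hc k, mul_smul]

variable (𝒜) in
/-- A family of linear forms without common zeros, none of which is a zero divisor, such that
`a / y₀ ^ N` is a linear form if it is a fraction of degree one that is regular away from the
zeros of each form of the family. -/
structure IsDeterminingFamily {K : Type*} (y : K → A) (k₀ : K) : Prop where
  mem (k : K) : y k ∈ 𝒜 1
  cover (x : ProjectiveSpectrum 𝒜) : ∃ k, y k ∈ complAt x
  regular (k : K) (a : A) : y k * a = 0 → a = 0
  dvd (N : ℕ) (a : A) : a ∈ 𝒜 (N + 1) → (∀ k, ∃ M, y k₀ ^ N ∣ y k ^ M * a) → y k₀ ^ N ∣ a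

namespace IsDeterminingFamily

variable {K : Type*} {y : K → A} {k₀ : K} (hy : IsDeterminingFamily 𝒜 y k₀)
include hy

theorem pow_regular (k : K) (N : ℕ) (a : A) (h : y k ^ N * a = 0) : a = 0 := by
  induction N with
  | zero => simpa using h
  | succ N ih => exact ih (hy.regular k _ (by rw [← h]; ring))

theorem pow_mem (k : K) (N : ℕ) : y k ^ N ∈ 𝒜 N := by
  simpa using SetLike.pow_mem_graded N (hy.mem k)

theorem eq_zero_of_toLocAt {i : ℕ} {n : A ⊗[ℂ] E} (hn : n ∈ tensorDegree 𝒜 E i)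
    (h : ∀ x : ProjectiveSpectrum 𝒜, toLocAt x n = 0) : n = 0 := by
  obtain ⟨N, hN⟩ := exists_pow_smul_eq_zero hn (hy.mem k₀) one_pos fun x _ => h x
  exact smul_injective_tensor (hy.pow_regular k₀ N) hN

/-- Global sections of `𝒪(1) ⊗ E` are elements of degree one of `A ⊗ E`. -/
theorem exists_eq_toLocAt (σ : twistSections 𝒜 E 1 ⊤) :
    ∃ n ∈ tensorDegree 𝒜 E 1, ∀ x, σ.1 x = toLocAt x.1 n := by
  choose N i n hi hn e using fun k =>
    exists_fraction_of_basicOpen_le σ (hy.mem k) (fun _ _ => trivial)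
  replace hi (k) : i k = N k + 1 := by have := hi k; omega
  -- The two fractions agree on `D(y k * y k₀)`, so this holds up to a power of `y k * y k₀`, which
  -- can be cancelled.
  have compat (k) : y k ^ N k • n k₀ = y k₀ ^ N k₀ • n k := by
    rw [← sub_eq_zero]
    have h1 : y k ^ N k • n k₀ ∈ tensorDegree 𝒜 E (N k + i k₀) :=
      smul_mem_tensorDegree (hy.pow_mem k _) (hn k₀)
    have h2 : y k₀ ^ N k₀ • n k ∈ tensorDegree 𝒜 E (N k + i k₀) := by
      rw [show N k + i k₀ = N k₀ + i k by rw [hi, hi]; omega]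
      exact smul_mem_tensorDegree (hy.pow_mem k₀ _) (hn k)
    obtain ⟨M, hM⟩ := exists_pow_smul_eq_zero (sub_mem h1 h2)
      (SetLike.mul_mem_graded (hy.mem k) (hy.mem k₀)) (by omega) fun x hx => by
        have hx1 : y k ∈ complAt x := fun h => hx (Ideal.mul_mem_right _ _ h)
        have hx2 : y k₀ ∈ complAt x := fun h => hx (Ideal.mul_mem_left _ _ h)
        rw [map_sub, map_smul, map_smul, ← e k x hx1, ← e k₀ x hx2, smul_comm, sub_self]
    rw [mul_pow, mul_smul] at hM
    exact smul_injective_tensor (hy.pow_regular k₀ M)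
      (smul_injective_tensor (hy.pow_regular k M) hM)
  obtain ⟨m, hm⟩ : ∃ m, n k₀ = y k₀ ^ N k₀ • m := by
    let B := Module.Basis.ofVectorSpace ℂ E
    refine exists_smul_eq_of_repr (Algebra.TensorProduct.basis A B) fun l => ?_
    refine hy.dvd _ _ (hi k₀ ▸ repr_mem_of_mem_tensorDegree (hn k₀) B l) fun k => ⟨N k, ?_⟩
    have := congr((Algebra.TensorProduct.basis A B).repr $(compat k) l)
    simp only [map_smul, Finsupp.smul_apply, smul_eq_mul] at this
    exact ⟨_, this⟩
  -- The quotient `m` need not be homogeneous, but its degree one part has the same product with `y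
  -- k₀ ^ N k₀`.
  have hm' : n k₀ = y k₀ ^ N k₀ • tensorProj 𝒜 E 1 m := by
    rw [← tensorProj_smul (hy.pow_mem k₀ _), ← hm, ← hi, tensorProj_of_mem (hn k₀)]
  refine ⟨_, tensorProj_mem 𝒜 1 m, fun x => ?_⟩
  obtain ⟨k, hk⟩ := hy.cover x.1
  refine smul_right_injective_locAt (_root_.pow_mem hk (N k)) ?_
  refine (e k x.1 hk).trans ?_
  rw [← map_smul]
  congr 1
  have := compat k
  rw [hm', smul_comm] at this
  exact (smul_left_cancel_tensor (hy.pow_regular k₀ _) this).symm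

end IsDeterminingFamily

end GlobalSections

/-! ### Independence of the equation of the quadric from the basis. -/

section Coordinates

variable {V ι κ : Type u} [AddCommGroup V] [Module ℂ V] [Fintype ι] [Fintype κ]
  (b : Module.Basis ι ℂ V) (b' : Module.Basis κ ℂ V) (q : QuadraticForm ℂ V)

/-- A linear form on `V` as a polynomial in the coordinates. -/
noncomputable def linPoly : Module.Dual ℂ V →ₗ[ℂ] MvPolynomial ι ℂ where
  toFun l := ∑ i, MvPolynomial.C (l (b i)) * MvPolynomial.X i
  map_add' l l' := by simp [add_mul, Finset.sum_add_distrib]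
  map_smul' c l := by simp [Finset.smul_sum, MvPolynomial.smul_eq_C_mul, mul_assoc]

theorem linPoly_apply (l : Module.Dual ℂ V) :
    linPoly b l = ∑ i, MvPolynomial.C (l (b i)) * MvPolynomial.X i := rfl

theorem linPoly_coord (i : ι) : linPoly b (b.coord i) = MvPolynomial.X i := by
  classical
  simp [linPoly_apply, Finsupp.single_apply]

theorem linPoly_isHomogeneous (l : Module.Dual ℂ V) : (linPoly b l).IsHomogeneous 1 :=
  MvPolynomial.IsHomogeneous.sum _ _ _ fun i _ => (MvPolynomial.isHomogeneous_X ℂ i).C_mul _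

theorem eval_linPoly (c : ι → ℂ) (l : Module.Dual ℂ V) :
    MvPolynomial.eval c (linPoly b l) = l (∑ i, c i • b i) := by
  simp [linPoly_apply, mul_comm]

theorem sum_coord_apply_smul (l : Module.Dual ℂ V) : ∑ i, l (b i) • b.coord i = l := by
  refine b.ext fun j => ?_
  classical
  simp

/-- The change of coordinates between polynomial rings. -/
noncomputable def changeCoordHom : MvPolynomial ι ℂ →ₐ[ℂ] MvPolynomial κ ℂ :=
  MvPolynomial.aeval fun i => linPoly b' (b.coord i)

theorem changeCoordHom_linPoly (l : Module.Dual ℂ V) :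
    changeCoordHom b b' (linPoly b l) = linPoly b' l := by
  conv_rhs => rw [← sum_coord_apply_smul b l, map_sum]
  simp only [map_smul, linPoly_apply b, changeCoordHom, map_sum, map_mul, MvPolynomial.aeval_X,
    MvPolynomial.aeval_C, Algebra.smul_def]

theorem changeCoordHom_comp :
    (changeCoordHom b' b).comp (changeCoordHom b b') = AlgHom.id ℂ _ :=
  MvPolynomial.algHom_ext fun i => by
    rw [AlgHom.comp_apply, AlgHom.id_apply, ← linPoly_coord b i, changeCoordHom_linPoly,
      changeCoordHom_linPoly]

/-- The change of coordinates between polynomial rings, as an equivalence. -/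
noncomputable def changeCoord : MvPolynomial ι ℂ ≃ₐ[ℂ] MvPolynomial κ ℂ :=
  AlgEquiv.ofAlgHom (changeCoordHom b b') (changeCoordHom b' b)
    (changeCoordHom_comp b' b) (changeCoordHom_comp b b')

theorem changeCoord_symm_X (k : κ) :
    (changeCoord b b').symm (MvPolynomial.X k) = linPoly b (b'.coord k) := by
  rw [← linPoly_coord b' k]
  exact changeCoordHom_linPoly b' b _

theorem aeval_apply_eq_eval {κ : Type u} (c : κ → ℂ) (p : MvPolynomial κ ℂ) :
    MvPolynomial.aeval c p = MvPolynomial.eval c p :=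
  congr($(MvPolynomial.coe_aeval_eq_eval c) p)

/-- At each point both polynomials evaluate to the value of `q` at the same vector, and polynomials
over an infinite field are determined by their values. -/
theorem changeCoord_quadPoly : changeCoord b b' (quadPoly b q) = quadPoly b' q := by
  refine MvPolynomial.funext fun c => ?_
  have : ((MvPolynomial.aeval c).comp (changeCoordHom b b')) =
      MvPolynomial.aeval (R := ℂ) fun i => b.coord i (∑ k, c k • b' k) :=
    MvPolynomial.algHom_ext fun i => by
      rw [AlgHom.comp_apply, changeCoordHom, MvPolynomial.aeval_X, MvPolynomial.aeval_X,
        aeval_apply_eq_eval, eval_linPoly]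
  have := congr($this (quadPoly b q))
  rw [AlgHom.comp_apply, aeval_apply_eq_eval, aeval_apply_eq_eval,
    eval_quadPoly] at this
  refine this.trans ?_
  rw [eval_quadPoly]
  congr 1
  exact b.sum_repr _

end Coordinates

/-! ### The coordinate ring as a quotient of polynomials in one distinguished coordinate. -/

section Presentation

variable {V ι κ : Type u} [AddCommGroup V] [Module ℂ V] [Fintype ι] [Fintype κ]
  (b : Module.Basis ι ℂ V) (b' : Module.Basis (Option κ) ℂ V) (q : QuadraticForm ℂ V)

/-- The coefficient of the first power of the distinguished coordinate in a quadratic form. -/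
noncomputable def quadLinCoeff : MvPolynomial κ ℂ :=
  ∑ k, (MvPolynomial.C (QuadraticMap.associated (R := ℂ) q (b' none) (b' (some k))) +
    MvPolynomial.C (QuadraticMap.associated (R := ℂ) q (b' (some k)) (b' none))) *
      MvPolynomial.X k

/-- The part of a quadratic form that does not involve the distinguished coordinate. -/
noncomputable def quadConstCoeff : MvPolynomial κ ℂ :=
  ∑ k, ∑ l, MvPolynomial.C (QuadraticMap.associated (R := ℂ) q (b' (some k)) (b' (some l))) *
    (MvPolynomial.X k * MvPolynomial.X l)

theorem optionEquivLeft_quadPoly :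
    MvPolynomial.optionEquivLeft ℂ κ (quadPoly b' q) =
      Polynomial.C (MvPolynomial.C (q (b' none))) * Polynomial.X ^ 2 +
        Polynomial.C (quadLinCoeff b' q) * Polynomial.X + Polynomial.C (quadConstCoeff b' q) := by
  rw [← QuadraticMap.associated_eq_self_apply ℂ q (b' none)]
  simp only [quadPoly, quadLinCoeff, quadConstCoeff, Fintype.sum_option, map_sum, map_mul, map_add,
    MvPolynomial.optionEquivLeft_C, MvPolynomial.optionEquivLeft_X_some,
    MvPolynomial.optionEquivLeft_X_none, Finset.sum_add_distrib, Finset.sum_mul, add_mul]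
  have h1 (k : κ) (c : MvPolynomial κ ℂ) : Polynomial.C c * (Polynomial.X *
      Polynomial.C (MvPolynomial.X k)) = Polynomial.C c * Polynomial.C (MvPolynomial.X k) *
      Polynomial.X := by ring
  have h2 (k : κ) (c : MvPolynomial κ ℂ) : Polynomial.C c * (Polynomial.C (MvPolynomial.X k) *
      Polynomial.X) = Polynomial.C c * Polynomial.C (MvPolynomial.X k) *
      Polynomial.X := by ring
  simp only [h1, h2]
  ring

variable {b'} {q}

/-- The leading coefficient in the distinguished coordinate is the nonzero constant `q (b' none)`.
Dividing by it gives a monic polynomial, by which division with remainder is possible. -/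
theorem exists_unit_mul_quadratic (h : q (b' none) ≠ 0) :
    ∃ (c : ℂ) (p : Polynomial (MvPolynomial κ ℂ)), c ≠ 0 ∧ p.Monic ∧ p.degree = 2 ∧
      MvPolynomial.optionEquivLeft ℂ κ (quadPoly b' q) =
        Polynomial.C (MvPolynomial.C c) * p := by
  let p : Polynomial (MvPolynomial κ ℂ) := Polynomial.C 1 * Polynomial.X ^ 2 +
    Polynomial.C (MvPolynomial.C (q (b' none))⁻¹ * quadLinCoeff b' q) * Polynomial.X +
      Polynomial.C (MvPolynomial.C (q (b' none))⁻¹ * quadConstCoeff b' q)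
  have hdeg : p.degree = 2 := Polynomial.degree_quadratic one_ne_zero
  refine ⟨q (b' none), p, h, Polynomial.leadingCoeff_quadratic one_ne_zero, hdeg, ?_⟩
  have hc : (MvPolynomial.C (q (b' none)) * MvPolynomial.C (q (b' none))⁻¹ :
      MvPolynomial κ ℂ) = 1 := by
    rw [← map_mul, mul_inv_cancel₀ h, map_one]
  rw [optionEquivLeft_quadPoly, mul_add, mul_add, ← mul_assoc, ← mul_assoc, ← map_mul, ← map_mul,
    ← map_mul, ← mul_assoc, ← mul_assoc, hc, one_mul, one_mul, mul_one]

variable (q)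

/-- The polynomials in all but the distinguished coordinate, as elements of the coordinate ring. -/
noncomputable def partHom : MvPolynomial κ ℂ →ₐ[ℂ] coordRing b q :=
  MvPolynomial.aeval fun k => Ideal.Quotient.mk _ (linPoly b (b'.coord (some k)))

variable (b')

/-- The quotient map to the coordinate ring, in terms of polynomials in the distinguished
coordinate. -/
noncomputable def presentation : Polynomial (MvPolynomial κ ℂ) →ₐ[ℂ] coordRing b q :=
  (Ideal.Quotient.mkₐ ℂ _).comp
    ((changeCoord b b').trans (MvPolynomial.optionEquivLeft ℂ κ)).symm.toAlgHom

theorem presentation_surjective : Function.Surjective (presentation b b' q) :=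
  (Ideal.Quotient.mkₐ_surjective ℂ _).comp (AlgEquiv.surjective _)

theorem presentation_eq_zero_iff (p : Polynomial (MvPolynomial κ ℂ)) :
    presentation b b' q p = 0 ↔ MvPolynomial.optionEquivLeft ℂ κ (quadPoly b' q) ∣ p := by
  rw [← changeCoord_quadPoly b b' q]
  change Ideal.Quotient.mk _ _ = 0 ↔ _
  rw [Ideal.Quotient.eq_zero_iff_mem, Ideal.mem_span_singleton]
  change quadPoly b q ∣ ((changeCoord b b').trans (MvPolynomial.optionEquivLeft ℂ κ)).symm p ↔
    ((changeCoord b b').trans (MvPolynomial.optionEquivLeft ℂ κ)) (quadPoly b q) ∣ p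
  conv_rhs =>
    rw [← ((changeCoord b b').trans (MvPolynomial.optionEquivLeft ℂ κ)).apply_symm_apply p]
  exact (map_dvd_iff _).symm

theorem presentation_C (f : MvPolynomial κ ℂ) :
    presentation b b' q (Polynomial.C f) = partHom b (b' := b') q f := by
  have : (presentation b b' q).comp (Polynomial.CAlgHom (R := ℂ)) = partHom b (b' := b') q := by
    refine MvPolynomial.algHom_ext fun k => ?_
    rw [partHom, MvPolynomial.aeval_X, ← changeCoord_symm_X,
      ← MvPolynomial.optionEquivLeft_symm_C_X]
    rfl
  exact congr($this f)

theorem presentation_X :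
    presentation b b' q Polynomial.X = Ideal.Quotient.mk _ (linPoly b (b'.coord none)) := by
  rw [← changeCoord_symm_X, ← MvPolynomial.optionEquivLeft_symm_X]
  rfl

end Presentation

/-! ### The coordinate ring as a free module of rank two, and the determining family. -/

section Family

variable {V ι κ : Type u} [AddCommGroup V] [Module ℂ V] [Fintype ι] [Fintype κ]
  (b : Module.Basis ι ℂ V) (b' : Module.Basis (Option κ) ℂ V) {q : QuadraticForm ℂ V}

/-- Division with remainder by the monic quadratic equation: `1` and the distinguished coordinate
generate the coordinate ring over the polynomials in the other coordinates. -/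
theorem exists_eq_partHom_add (h : q (b' none) ≠ 0) (a : coordRing b q) :
    ∃ f g, a = partHom b (b' := b') q f + partHom b (b' := b') q g *
      Ideal.Quotient.mk _ (linPoly b (b'.coord none)) := by
  obtain ⟨c, p, hc, hp, hdeg, e⟩ := exists_unit_mul_quadratic h
  obtain ⟨r, rfl⟩ := presentation_surjective b b' q a
  have hp0 : presentation b b' q p = 0 := by
    rw [presentation_eq_zero_iff, e]
    refine ((Polynomial.isUnit_C.2 ?_).mul_left_dvd).2 dvd_rfl
    exact (isUnit_iff_ne_zero.2 hc).map MvPolynomial.C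
  have hlt : (r %ₘ p).degree < 2 := hdeg ▸ Polynomial.degree_modByMonic_lt r hp
  have hlin := Polynomial.eq_X_add_C_of_degree_le_one (p := r %ₘ p)
    (Order.le_of_lt_succ (by exact_mod_cast hlt))
  refine ⟨(r %ₘ p).coeff 0, (r %ₘ p).coeff 1, ?_⟩
  rw [← presentation_C, ← presentation_C, ← presentation_X, ← map_mul, ← map_add,
    add_comm (Polynomial.C _), ← hlin]
  conv_lhs => rw [← Polynomial.modByMonic_add_div r p]
  rw [map_add, map_mul, hp0, zero_mul, add_zero]

/-- A polynomial of degree at most one in the distinguished coordinate is not a multiple of a monic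
quadratic unless it is zero. So the two generators are independent. -/
theorem eq_zero_of_partHom_add_eq_zero (h : q (b' none) ≠ 0) {f g : MvPolynomial κ ℂ}
    (hfg : partHom b (b' := b') q f + partHom b (b' := b') q g *
      Ideal.Quotient.mk _ (linPoly b (b'.coord none)) = 0) : f = 0 ∧ g = 0 := by
  obtain ⟨c, p, hc, hp, hdeg, e⟩ := exists_unit_mul_quadratic h
  rw [← presentation_C, ← presentation_C, ← presentation_X, ← map_mul, ← map_add,
    presentation_eq_zero_iff, e] at hfg
  have h0 : Polynomial.C f + Polynomial.C g * Polynomial.X = 0 := by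
    by_contra hne
    refine hp.not_dvd_of_degree_lt hne ?_ (dvd_of_mul_left_dvd hfg)
    rw [hdeg, add_comm]
    exact Polynomial.degree_linear_lt
  constructor
  · simpa using congr(Polynomial.coeff $h0 0)
  · simpa using congr(Polynomial.coeff $h0 1)

theorem linPoly_mem (l : Module.Dual ℂ V) :
    Ideal.Quotient.mk _ (linPoly b l) ∈ coordGrading b q 1 :=
  ⟨_, linPoly_isHomogeneous b l, rfl⟩

theorem exists_coordFn_mem_compl (x : ProjectiveSpectrum (coordGrading b q)) :
    ∃ i, coordFn b q i ∈ complAt x := by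
  by_contra! hx
  obtain ⟨j, _, hj, ⟨p, hp, rfl⟩, hpx⟩ := exists_mem_compl x 1
  refine hpx ?_
  have hmap : (Ideal.Quotient.mkₐ ℂ x.asHomogeneousIdeal.toIdeal).comp
      (Ideal.Quotient.mkₐ ℂ (Ideal.span {quadPoly b q})) = MvPolynomial.aeval fun _ => 0 :=
    MvPolynomial.algHom_ext fun i => by
      rw [MvPolynomial.aeval_X]
      exact Ideal.Quotient.eq_zero_iff_mem.2 (not_not.1 (hx i))
  have := congr($hmap p)
  refine Ideal.Quotient.eq_zero_iff_mem.1 (this.trans ?_)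
  have h0 : MvPolynomial.constantCoeff p = 0 := hp.coeff_eq_zero (by simp; omega)
  rw [MvPolynomial.aeval_zero', h0, map_zero]

/-- The only common zero of these coordinates in projective space is the line of `b' none`, which is
not on the quadric: the equation reduces to `q (b' none) * z ^ 2 = 0`. -/
theorem exists_linPoly_some_mem_compl (h : q (b' none) ≠ 0)
    (x : ProjectiveSpectrum (coordGrading b q)) :
    ∃ k, (Ideal.Quotient.mk _ (linPoly b (b'.coord (some k))) : coordRing b q) ∈ complAt x := by
  by_contra! hx
  have hpart (f : MvPolynomial κ ℂ) (hf : MvPolynomial.constantCoeff f = 0) :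
      partHom b (b' := b') q f ∈ x.asHomogeneousIdeal.toIdeal := by
    have hmap : (Ideal.Quotient.mkₐ ℂ x.asHomogeneousIdeal.toIdeal).comp
        (partHom b (b' := b') q) = MvPolynomial.aeval fun _ => 0 :=
      MvPolynomial.algHom_ext fun k => by
        rw [AlgHom.comp_apply, partHom, MvPolynomial.aeval_X, MvPolynomial.aeval_X]
        exact Ideal.Quotient.eq_zero_iff_mem.2 (not_not.1 (hx k))
    refine Ideal.Quotient.eq_zero_iff_mem.1 (congr($hmap f).trans ?_)
    rw [MvPolynomial.aeval_zero', hf, map_zero]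
  have hz : (Ideal.Quotient.mk _ (linPoly b (b'.coord none)) : coordRing b q) ∈
      x.asHomogeneousIdeal.toIdeal := by
    have h0 := (presentation_eq_zero_iff b b' q _).2 dvd_rfl
    rw [optionEquivLeft_quadPoly] at h0
    simp only [map_add, map_mul, map_pow, presentation_C, presentation_X] at h0
    have hl := hpart (quadLinCoeff b' q) (by simp [quadLinCoeff])
    have hm := hpart (quadConstCoeff b' q) (by simp [quadConstCoeff])
    set z : coordRing b q := Ideal.Quotient.mk _ (linPoly b (b'.coord none))
    have hq : partHom b (b' := b') q (MvPolynomial.C (q (b' none))) * z ^ 2 ∈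
        x.asHomogeneousIdeal.toIdeal := by
      rw [add_assoc] at h0
      rw [eq_neg_of_add_eq_zero_left h0]
      exact neg_mem (add_mem (Ideal.mul_mem_right _ _ hl) hm)
    have hu : IsUnit (partHom b (b' := b') q (MvPolynomial.C (q (b' none)))) :=
      (((isUnit_iff_ne_zero.2 h).map MvPolynomial.C)).map _
    exact x.2.mem_of_pow_mem 2 ((Ideal.unit_mul_mem_iff_mem _ hu).1 hq)
  obtain ⟨i, hi⟩ := exists_coordFn_mem_compl b x
  refine hi ?_
  rw [coordFn, ← linPoly_coord b i, ← sum_coord_apply_smul b' (b.coord i), map_sum, map_sum]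
  refine sum_mem fun o _ => ?_
  rw [map_smul, MvPolynomial.smul_eq_C_mul, map_mul]
  refine Ideal.mul_mem_left _ _ ?_
  cases o with
  | none => exact hz
  | some k => exact not_not.1 (hx k)

theorem X_pow_dvd_of_isHomogeneous [Subsingleton κ] (k : κ) {N : ℕ}
    {f : MvPolynomial κ ℂ}
    (hf : f.IsHomogeneous N) : MvPolynomial.X k ^ N ∣ f := by
  rw [f.as_sum]
  refine Finset.dvd_sum fun m hm => ?_
  have hdeg : m.degree = N := by
    by_contra hne
    exact MvPolynomial.mem_support_iff.1 hm (hf.coeff_eq_zero hne)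
  have : m = Finsupp.single k N := by
    have : Unique κ := ⟨⟨k⟩, fun _ => Subsingleton.elim _ _⟩
    rw [Finsupp.unique_single m, Finsupp.degree_single] at hdeg
    rw [Finsupp.unique_single m, hdeg, Subsingleton.elim default k]
  rw [this]
  exact ⟨MvPolynomial.C _, by rw [mul_comm, MvPolynomial.C_mul_X_pow_eq_monomial]⟩

theorem partHom_mem {f : MvPolynomial κ ℂ} {i : ℕ} (hf : f.IsHomogeneous i) :
    partHom b (b' := b') q f ∈ coordGrading b q i := by
  have : partHom b (b' := b') q = (Ideal.Quotient.mkₐ ℂ _).comp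
      (MvPolynomial.aeval fun k => linPoly b (b'.coord (some k))) :=
    MvPolynomial.algHom_ext fun k => by
      rw [AlgHom.comp_apply, partHom, MvPolynomial.aeval_X, MvPolynomial.aeval_X]
      rfl
  rw [this]
  refine ⟨_, ?_, rfl⟩
  simpa using hf.aeval (n := 1) (fun k => linPoly b (b'.coord (some k)))
    fun k => linPoly_isHomogeneous b _

theorem proj_partHom (i : ℕ) (f : MvPolynomial κ ℂ) :
    GradedAlgebra.proj (coordGrading b q) i (partHom b (b' := b') q f) =
      partHom b (b' := b') q (MvPolynomial.homogeneousComponent i f) := by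
  have key (j : ℕ) : GradedAlgebra.proj (coordGrading b q) i
      (partHom b (b' := b') q (MvPolynomial.homogeneousComponent j f)) =
      if j = i then partHom b (b' := b') q (MvPolynomial.homogeneousComponent i f) else 0 := by
    have hj := partHom_mem b b' (q := q)
      (MvPolynomial.homogeneousComponent_isHomogeneous j f)
    split_ifs with hji
    · subst hji
      exact DirectSum.decompose_of_mem_same _ hj
    · exact DirectSum.decompose_of_mem_ne _ hj hji
  conv_lhs => rw [← MvPolynomial.sum_homogeneousComponent f]
  rw [map_sum, map_sum, Finset.sum_congr rfl fun j _ => key j, Finset.sum_ite_eq']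
  split_ifs with hi
  · rfl
  · rw [MvPolynomial.homogeneousComponent_eq_zero _ _ (by simpa using hi), map_zero]

/-- With respect to the basis `1, z`, multiplication and divisibility by polynomials in the other
coordinates can be tested on the two coefficients, in a polynomial ring. -/
theorem isDeterminingFamily (h : q (b' none) ≠ 0) (k₀ : κ) :
    IsDeterminingFamily (coordGrading b q)
      (fun k : κ => Ideal.Quotient.mk _ (linPoly b (b'.coord (some k)))) k₀ where
  mem k := linPoly_mem b _
  cover := exists_linPoly_some_mem_compl b b' h
  regular k a ha := by
    obtain ⟨f, g, rfl⟩ := exists_eq_partHom_add b b' h a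
    have hk : partHom b (b' := b') q (MvPolynomial.X k) =
      Ideal.Quotient.mk _ (linPoly b (b'.coord (some k))) := MvPolynomial.aeval_X _ _
    rw [← hk, mul_add, ← mul_assoc, ← map_mul, ← map_mul] at ha
    obtain ⟨hf, hg⟩ := eq_zero_of_partHom_add_eq_zero b b' h ha
    rw [(mul_eq_zero_iff_left (MvPolynomial.X_ne_zero k)).1 hf,
      (mul_eq_zero_iff_left (MvPolynomial.X_ne_zero k)).1 hg, map_zero, zero_mul, add_zero]
  dvd N a ha hdvd := by
    have hk (k) : partHom b (b' := b') q (MvPolynomial.X k) =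
      Ideal.Quotient.mk _ (linPoly b (b'.coord (some k))) := MvPolynomial.aeval_X _ _
    simp only [← hk] at hdvd ⊢
    -- If `V` is a plane there is one remaining coordinate, and homogeneity alone suffices: the
    -- coefficients of `1` and `z` have degrees `N + 1` and `N`. In degree `N`, that is for sections
    -- of `𝒪`, the second would be one degree short.
    by_cases hκ : Subsingleton κ
    · obtain ⟨f, g, rfl⟩ := exists_eq_partHom_add b b' h a
      have hproj := DirectSum.decompose_of_mem_same _ ha
      rw [← GradedAlgebra.proj_apply, map_add, proj_partHom, mul_comm (partHom b q g), add_comm N 1,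
        proj_mul_left (linPoly_mem b _), proj_partHom] at hproj
      rw [mul_comm (partHom b q g), ← hproj, ← map_pow]
      have hf := X_pow_dvd_of_isHomogeneous k₀
        (MvPolynomial.homogeneousComponent_isHomogeneous (1 + N) f)
      have hg := X_pow_dvd_of_isHomogeneous k₀
        (MvPolynomial.homogeneousComponent_isHomogeneous N g)
      exact dvd_add (map_dvd _ ((pow_dvd_pow _ (by omega)).trans hf))
        ((map_dvd _ hg).mul_left _)
    -- With a second coordinate `X k`, the prime `X k₀` does not divide `X k ^ M`, so `X k₀ ^ N`
    -- divides each coefficient.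
    · have := not_subsingleton_iff_nontrivial.1 hκ
      obtain ⟨k, hkk⟩ := exists_ne k₀
      obtain ⟨M, c, hc⟩ := hdvd k
      obtain ⟨f, g, rfl⟩ := exists_eq_partHom_add b b' h a
      obtain ⟨f', g', rfl⟩ := exists_eq_partHom_add b b' h c
      rw [← sub_eq_zero, mul_add, mul_add, ← mul_assoc, ← mul_assoc] at hc
      simp only [← map_pow, ← map_mul] at hc
      rw [add_sub_add_comm, ← sub_mul, ← map_sub, ← map_sub] at hc
      obtain ⟨hf, hg⟩ := eq_zero_of_partHom_add_eq_zero b b' h hc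
      have hprime : Prime (MvPolynomial.X k₀ : MvPolynomial κ ℂ) := MvPolynomial.X_prime
      have hnd : ¬ (MvPolynomial.X k₀ : MvPolynomial κ ℂ) ∣ MvPolynomial.X k ^ M := fun hd =>
        hkk (MvPolynomial.X_dvd_X.1 (hprime.dvd_of_dvd_pow hd)).symm
      have hf' := hprime.pow_dvd_of_dvd_mul_left N hnd ⟨_, sub_eq_zero.1 hf⟩
      have hg' := hprime.pow_dvd_of_dvd_mul_left N hnd ⟨_, sub_eq_zero.1 hg⟩
      rw [← map_pow]
      exact dvd_add (map_dvd _ hf') ((map_dvd _ hg').mul_right _)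

variable {b} in
/-- The quadric of a nonzero quadratic form in at least two variables has a determining family. -/
theorem exists_isDeterminingFamily (hq : q ≠ 0) (hV : 2 ≤ Module.finrank ℂ V) :
    ∃ (K : Type u) (y : K → coordRing b q) (k₀ : K),
      IsDeterminingFamily (coordGrading b q) y k₀ := by
  classical
  obtain ⟨e, he⟩ : ∃ e, q e ≠ 0 := by
    by_contra! h
    exact hq (QuadraticMap.ext h)
  have he0 : e ≠ 0 := fun h => he (by rw [h, map_zero])
  have hli : LinearIndepOn ℂ id {e} := LinearIndepOn.singleton he0
  let B := Module.Basis.extend hli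
  have : Module.Finite ℂ V := Module.Finite.of_basis b
  have : Fintype (hli.extend (Set.subset_univ _)) := FiniteDimensional.fintypeBasisIndex B
  let o : hli.extend (Set.subset_univ _) := ⟨e, hli.subset_extend _ rfl⟩
  let b' := B.reindex (Equiv.optionSubtypeNe o).symm
  have hb' : b' none = e := by simp [b', B, o]
  have hcard : Fintype.card (Option {x // x ≠ o}) = Module.finrank ℂ V :=
    (Module.finrank_eq_card_basis b').symm
  rw [Fintype.card_option] at hcard
  -- This is where `dim V ≥ 2` enters: the basis has a vector besides `e`.
  obtain ⟨k₀⟩ : Nonempty {x // x ≠ o} := Fintype.card_pos_iff.1 (by omega)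
  exact ⟨_, _, k₀, isDeterminingFamily b b' (hb'.symm ▸ he) k₀⟩

end Family

/-! ### Matrix factorizations of the quadratic form and exactness over the coordinate ring. -/

section LinearMatrix

variable {ι : Type u} [Fintype ι] {E E' : Type u} [AddCommGroup E] [Module ℂ E]
  [AddCommGroup E'] [Module ℂ E']

/-- The matrix of linear forms `∑ xᵢ ⊗ aᵢ`. -/
noncomputable def linearMatrix {R : Type u} [CommRing R] [Algebra ℂ R] (x : ι → R)
    (a : ι → E →ₗ[ℂ] E') : R ⊗[ℂ] E →ₗ[R] R ⊗[ℂ] E' :=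
  ∑ i, x i • (a i).baseChange R

section

variable {R : Type u} [CommRing R] [Algebra ℂ R] (x : ι → R) (a : ι → E →ₗ[ℂ] E')
  (a' : ι → E' →ₗ[ℂ] E)

theorem linearMatrix_tmul (r : R) (e : E) :
    linearMatrix x a (r ⊗ₜ e) = ∑ i, (x i * r) ⊗ₜ a i e := by
  simp [linearMatrix, TensorProduct.smul_tmul']

variable {a a'} in
theorem linearMatrix_comp {β : ι → ι → ℂ}
    (h : ∀ i j e, a' i (a j e) + a' j (a i e) = (2 * β i j) • e) (n : R ⊗[ℂ] E) :
    linearMatrix x a' (linearMatrix x a n) = (∑ i, ∑ j, β i j • (x i * x j)) • n := by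
  induction n with
  | zero => simp
  | add n m hn hm => rw [map_add, map_add, hn, hm, smul_add]
  | tmul r e =>
    have h2 : (2 : ℂ) ≠ 0 := two_ne_zero
    -- Doubling the double sum allows it to be symmetrized in `i` and `j`, so that the Clifford
    -- relation applies termwise.
    refine smul_right_injective _ h2 ?_
    simp only [linearMatrix_tmul, map_sum]
    rw [two_smul]
    nth_rw 1 [Finset.sum_comm]
    simp only [← Finset.sum_add_distrib, Finset.sum_smul, Finset.smul_sum]
    refine Finset.sum_congr rfl fun i _ => Finset.sum_congr rfl fun j _ => ?_
    rw [show x i * (x j * r) = x j * (x i * r) by ring, ← TensorProduct.tmul_add, h,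
      TensorProduct.tmul_smul, TensorProduct.smul_tmul', TensorProduct.smul_tmul',
      TensorProduct.smul_tmul', mul_smul, smul_eq_mul, smul_mul_assoc]
    rw [mul_assoc, mul_left_comm]

variable {𝒜 : ℕ → Submodule ℂ R} [GradedAlgebra 𝒜] {x}

theorem tensorProj_baseChange (f : E →ₗ[ℂ] E') (i : ℕ) (n : R ⊗[ℂ] E) :
    tensorProj 𝒜 E' i (f.baseChange R n) = f.baseChange R (tensorProj 𝒜 E i n) := by
  induction n with
  | zero => simp
  | add n m hn hm => simp only [map_add, hn, hm]
  | tmul r e => simp [tensorProj]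

theorem tensorProj_linearMatrix (hx : ∀ i, x i ∈ 𝒜 1) (i : ℕ) (n : R ⊗[ℂ] E) :
    tensorProj 𝒜 E' (i + 1) (linearMatrix x a n) = linearMatrix x a (tensorProj 𝒜 E i n) := by
  simp only [linearMatrix, LinearMap.sum_apply, LinearMap.smul_apply, map_sum]
  refine Finset.sum_congr rfl fun j _ => ?_
  rw [add_comm, tensorProj_smul (hx j), tensorProj_baseChange]

theorem tensorProj_zero_linearMatrix (hx : ∀ i, x i ∈ 𝒜 1) (n : R ⊗[ℂ] E) :
    tensorProj 𝒜 E' 0 (linearMatrix x a n) = 0 := by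
  simp only [linearMatrix, LinearMap.sum_apply, LinearMap.smul_apply, map_sum]
  exact Finset.sum_eq_zero fun j _ => tensorProj_smul_of_lt (hx j) one_pos _

theorem linearMatrix_mem (hx : ∀ i, x i ∈ 𝒜 1) {i : ℕ} {n : R ⊗[ℂ] E}
    (hn : n ∈ tensorDegree 𝒜 E i) : linearMatrix x a n ∈ tensorDegree 𝒜 E' (i + 1) := by
  rw [← tensorProj_of_mem hn, ← tensorProj_linearMatrix a hx]
  exact tensorProj_mem 𝒜 _ _

end

section Quadric

variable {V : Type u} [AddCommGroup V] [Module ℂ V] (b : Module.Basis ι ℂ V)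
  {q : QuadraticForm ℂ V}

/-- Reduction modulo the equation of the quadric. -/
noncomputable def reduction (q : QuadraticForm ℂ V) (E : Type u) [AddCommGroup E] [Module ℂ E] :
    MvPolynomial ι ℂ ⊗[ℂ] E →ₗ[ℂ] coordRing b q ⊗[ℂ] E :=
  (Ideal.Quotient.mkₐ ℂ (Ideal.span {quadPoly b q})).toLinearMap.rTensor E

theorem reduction_surjective : Function.Surjective (reduction b q E) :=
  LinearMap.rTensor_surjective _ (Ideal.Quotient.mkₐ_surjective ℂ _)

theorem exists_eq_quadPoly_smul {n : MvPolynomial ι ℂ ⊗[ℂ] E} (hn : reduction b q E n = 0) :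
    ∃ m, n = quadPoly b q • m := by
  let B := Module.Basis.ofVectorSpace ℂ E
  refine exists_smul_eq_of_repr (Algebra.TensorProduct.basis _ B) fun k => ?_
  have key (n : MvPolynomial ι ℂ ⊗[ℂ] E) :
      (Algebra.TensorProduct.basis (coordRing b q) B).repr (reduction b q E n) k =
        Ideal.Quotient.mk _ ((Algebra.TensorProduct.basis (MvPolynomial ι ℂ) B).repr n k) := by
    induction n with
    | zero => simp
    | add n m hn hm => simp only [map_add, Finsupp.add_apply, hn, hm]
    | tmul r e =>
      rw [reduction, LinearMap.rTensor_tmul, Algebra.TensorProduct.basis_repr_tmul,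
        Algebra.TensorProduct.basis_repr_tmul]
      simp only [Finsupp.smul_apply, Finsupp.mapRange_apply, smul_eq_mul, map_mul]
      rfl
  rw [← Ideal.mem_span_singleton, ← Ideal.Quotient.eq_zero_iff_mem, ← key, hn, map_zero]
  rfl

theorem reduction_linearMatrix (a : ι → E →ₗ[ℂ] E') (n : MvPolynomial ι ℂ ⊗[ℂ] E) :
    reduction b q E' (linearMatrix MvPolynomial.X a n) =
      linearMatrix (coordFn b q) a (reduction b q E n) := by
  induction n with
  | zero => simp
  | add n m hn hm => simp only [map_add, hn, hm]
  | tmul r e =>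
    rw [linearMatrix_tmul, map_sum, reduction, reduction, LinearMap.rTensor_tmul, linearMatrix_tmul]
    rfl

theorem quadPoly_ne_zero (hq : q ≠ 0) : quadPoly b q ≠ 0 := by
  intro h
  refine hq (QuadraticMap.ext fun v => ?_)
  have := eval_quadPoly b q (b.repr v)
  rw [h, map_zero, b.sum_repr] at this
  exact this.symm

theorem quadPoly_eq_sum : quadPoly b q =
    ∑ i, ∑ j, QuadraticMap.associated (R := ℂ) q (b i) (b j) •
      (MvPolynomial.X i * MvPolynomial.X j) := by
  simp only [quadPoly, MvPolynomial.smul_eq_C_mul]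

variable (q) in
/-- A pair of maps of vector spaces depending linearly on a vector, whose composites are
multiplication by the value of the quadratic form. -/
def IsCliffordPair (a : ι → E →ₗ[ℂ] E') (a' : ι → E' →ₗ[ℂ] E) : Prop :=
  ∀ i j e, a' i (a j e) + a' j (a i e) =
    (2 * QuadraticMap.associated (R := ℂ) q (b i) (b j)) • e

variable {b} {a : ι → E →ₗ[ℂ] E'} {a' : ι → E' →ₗ[ℂ] E}

theorem IsCliffordPair.comp_eq_zero (h : IsCliffordPair b q a a') (n : coordRing b q ⊗[ℂ] E) :
    linearMatrix (coordFn b q) a' (linearMatrix (coordFn b q) a n) = 0 := by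
  rw [linearMatrix_comp _ h]
  have : (∑ i, ∑ j, QuadraticMap.associated (R := ℂ) q (b i) (b j) •
      (coordFn b q i * coordFn b q j)) = Ideal.Quotient.mkₐ ℂ _ (quadPoly b q) := by
    refine Eq.trans ?_ (congr(Ideal.Quotient.mkₐ ℂ (Ideal.span {quadPoly b q})
      $(quadPoly_eq_sum b (q := q)))).symm
    simp only [map_sum, map_smul, map_mul]
    rfl
  have h0 : Ideal.Quotient.mkₐ ℂ (Ideal.span {quadPoly b q}) (quadPoly b q) = 0 :=
    Ideal.Quotient.eq_zero_iff_mem.2 (Ideal.mem_span_singleton_self _)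
  rw [this, h0]
  exact zero_smul (coordRing b q) n

/-- The usual argument for matrix factorizations. Lift `n` to the polynomial ring, where `ψ n = q m
= ψ (φ m)`. Then `q (n - φ m) = φ (ψ (n - φ m)) = 0`, and `q` is a nonzerodivisor. -/
theorem IsCliffordPair.exists_eq (hq : q ≠ 0) (h : IsCliffordPair b q a a')
    (h' : IsCliffordPair b q a' a) {n : coordRing b q ⊗[ℂ] E'}
    (hn : linearMatrix (coordFn b q) a' n = 0) : ∃ m, n = linearMatrix (coordFn b q) a m := by
  have reg (p) (hp : quadPoly b q * p = 0) : p = 0 :=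
    (mul_eq_zero.1 hp).resolve_left (quadPoly_ne_zero b hq)
  obtain ⟨n, rfl⟩ := reduction_surjective b n
  rw [← reduction_linearMatrix] at hn
  obtain ⟨m, hm⟩ := exists_eq_quadPoly_smul b hn
  have h1 : linearMatrix MvPolynomial.X a' (n - linearMatrix MvPolynomial.X a m) = 0 := by
    rw [map_sub, hm, linearMatrix_comp _ h, ← quadPoly_eq_sum, sub_self]
  have h2 := linearMatrix_comp MvPolynomial.X h' (n - linearMatrix MvPolynomial.X a m)
  rw [h1, map_zero, ← quadPoly_eq_sum] at h2
  have h3 := sub_eq_zero.1 (smul_injective_tensor reg h2.symm)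
  exact ⟨reduction b q E m, by rw [← reduction_linearMatrix, ← h3]⟩

theorem IsCliffordPair.exists_mem (hq : q ≠ 0) (h : IsCliffordPair b q a a')
    (h' : IsCliffordPair b q a' a) {i : ℕ} {n : coordRing b q ⊗[ℂ] E'}
    (hni : n ∈ tensorDegree (coordGrading b q) E' (i + 1))
    (hn : linearMatrix (coordFn b q) a' n = 0) :
    ∃ m ∈ tensorDegree (coordGrading b q) E i, n = linearMatrix (coordFn b q) a m := by
  obtain ⟨m, hm⟩ := h.exists_eq hq h' hn
  refine ⟨_, tensorProj_mem _ i m, ?_⟩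
  rw [← tensorProj_linearMatrix a (coord_mem b q), ← hm, tensorProj_of_mem hni]

variable (b q)

theorem coordRing_nontrivial : Nontrivial (coordRing b q) := by
  refine Ideal.Quotient.nontrivial_iff.2 fun h => ?_
  have h1 := (Ideal.eq_top_iff_one _).1 h
  obtain ⟨c, hc⟩ := Ideal.mem_span_singleton.1 h1
  have := congr(MvPolynomial.eval (0 : ι → ℂ) $hc)
  rw [map_one, map_mul, eval_quadPoly] at this
  simp at this

variable {b q}

theorem exists_eq_one_tmul {n : coordRing b q ⊗[ℂ] E}
    (hn : n ∈ tensorDegree (coordGrading b q) E 0) : ∃ e, n = 1 ⊗ₜ e := by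
  refine tensorDegree_induction (p := fun n => ∃ e : E, n = 1 ⊗ₜ e) ⟨0, by simp⟩ ?_ ?_ hn
  · rintro _ ⟨p, hp, rfl⟩ e
    have hp' : p.IsHomogeneous 0 := hp
    rw [MvPolynomial.totalDegree_eq_zero_iff_eq_C.1 (Nat.le_zero.1 hp'.totalDegree_le)]
    refine ⟨p.coeff 0 • e, ?_⟩
    rw [TensorProduct.tmul_smul, TensorProduct.smul_tmul']
    exact congr($(Algebra.algebraMap_eq_smul_one (A := coordRing b q) (p.coeff 0)) ⊗ₜ e)
  · rintro _ _ _ _ ⟨e, rfl⟩ ⟨e', rfl⟩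
    exact ⟨e + e', (TensorProduct.tmul_add _ _ _).symm⟩

theorem one_tmul_mem (e : E) : (1 : coordRing b q) ⊗ₜ[ℂ] e ∈ tensorDegree (coordGrading b q) E 0 :=
  tmul_mem_tensorDegree (SetLike.one_mem_graded _) e

/-- The relation ideal is generated in degree two, so no nonzero linear form becomes zero. -/
theorem linearIndependent_coordFn : LinearIndependent ℂ (coordFn b q) := by
  let _ : GradedAlgebra (MvPolynomial.homogeneousSubmodule ι ℂ) := MvPolynomial.gradedAlgebra
  rw [Fintype.linearIndependent_iff]
  intro c hc i
  have h1 : Ideal.Quotient.mkₐ ℂ (Ideal.span {quadPoly b q}) (∑ i, c i • MvPolynomial.X i) = 0 := by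
    rw [map_sum, ← hc]
    exact Finset.sum_congr rfl fun i _ => map_smul _ _ _
  obtain ⟨d, hd⟩ := Ideal.mem_span_singleton.1 (Ideal.Quotient.eq_zero_iff_mem.1 h1)
  have h2 : ∑ i, c i • MvPolynomial.X i ∈ MvPolynomial.homogeneousSubmodule ι ℂ 1 :=
    sum_mem fun i _ => Submodule.smul_mem _ _ (MvPolynomial.isHomogeneous_X ℂ i)
  have h3 := proj_mul_left_of_lt (𝒜 := MvPolynomial.homogeneousSubmodule ι ℂ)
    (quadPoly_isHomogeneous b q) (k := 1) (by norm_num) d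
  rw [← hd, GradedAlgebra.proj_apply, DirectSum.decompose_of_mem_same _ h2] at h3
  classical
  simpa [MvPolynomial.coeff_X, MvPolynomial.coeff_sum, Finsupp.single_left_inj] using
    congr(MvPolynomial.coeff (Finsupp.single i 1) $h3)

theorem eq_zero_of_sum_tmul_eq_zero {R : Type u} [CommRing R] [Algebra ℂ R] {x : ι → R}
    (hx : LinearIndependent ℂ x) {e : ι → E} (h : ∑ i, x i ⊗ₜ[ℂ] e i = 0) (i : ι) : e i = 0 := by
  let B := Module.Basis.ofVectorSpace ℂ E
  refine B.repr.injective (Finsupp.ext fun k => ?_)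
  have := congr((Algebra.TensorProduct.basis R B).repr $h k)
  simp only [map_sum, Algebra.TensorProduct.basis_repr_tmul, Finsupp.finsetSum_apply] at this
  rw [map_zero]
  refine Fintype.linearIndependent_iff.1 hx (fun i => B.repr (e i) k) ?_ i
  simpa [Algebra.smul_def, mul_comm] using this

theorem one_tmul_eq_zero {e : E} (h : (1 : coordRing b q) ⊗ₜ[ℂ] e = 0) : e = 0 := by
  have := coordRing_nontrivial b q
  exact eq_zero_of_sum_tmul_eq_zero (ι := PUnit) (x := fun _ => (1 : coordRing b q))
    (.of_subsingleton PUnit.unit one_ne_zero) (e := fun _ => e) (by simpa using h) PUnit.unit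

/-- By exactness a kernel element is in the image of a matrix of linear forms, and such an image has
no component of degree zero. -/
theorem IsCliffordPair.one_tmul_injective (hq : q ≠ 0) (h : IsCliffordPair b q a a')
    (h' : IsCliffordPair b q a' a) {e : E'}
    (he : linearMatrix (coordFn b q) a' (1 ⊗ₜ e) = 0) : e = 0 := by
  obtain ⟨m, hm⟩ := h.exists_eq hq h' he
  refine one_tmul_eq_zero (b := b) (q := q) ?_
  rw [← tensorProj_of_mem (one_tmul_mem (b := b) (q := q) e), hm,
    tensorProj_zero_linearMatrix a (coord_mem b q)]

end Quadric

end LinearMatrix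

/-! ### Local criteria for epimorphisms and exactness of sheaves of modules. -/

section ModuleSheaves

open Limits

variable {X : Scheme.{u}}

theorem app_injective_of_mono {M N : X.Modules} (f : M ⟶ N) [Mono f] (U : X.Opens) :
    Function.Injective (f.app U) := by
  have h1 : Mono ((Scheme.Modules.toPresheaf X).map f) := inferInstance
  have h2 : Mono (f.app U) := (NatTrans.mono_iff_mono_app _).1 h1 (.op U)
  exact (AddCommGrpCat.mono_iff_injective _).1 h2

theorem epi_of_locally_surjective {M N : X.Modules} (f : M ⟶ N)
    (h : ∀ (U : X.Opens) (s : Γ(N, U)), ∀ x ∈ U, ∃ (V : X.Opens) (i : V ⟶ U), x ∈ V ∧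
      ∃ t : Γ(M, V), f.app V t = N.presheaf.map i.op s) : Epi f := by
  have h1 : TopCat.Presheaf.IsLocallySurjective
      ((SheafOfModules.toSheaf X.ringCatSheaf).map f).hom := by
    rw [TopCat.Presheaf.isLocallySurjective_iff]
    intro U s x hx
    obtain ⟨V, i, hV, t, ht⟩ := h U s x hx
    exact ⟨V, leOfHom i, ⟨t, ht⟩, hV⟩
  have h2 := (TopCat.Sheaf.isLocallySurjective_iff_epi
    ((SheafOfModules.toSheaf X.ringCatSheaf).map f)).1 h1
  exact (SheafOfModules.toSheaf X.ringCatSheaf).epi_of_epi_map h2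

/-- Local preimages say that the map to the kernel is locally surjective. The comparison takes place
in `S.X₂`, into which sections of the kernel inject. -/
theorem exact_of_locally_exact (S : ShortComplex X.Modules)
    (h : ∀ (U : X.Opens) (s : Γ(S.X₂, U)), S.g.app U s = 0 → ∀ x ∈ U,
      ∃ (V : X.Opens) (i : V ⟶ U), x ∈ V ∧
        ∃ t : Γ(S.X₁, V), S.f.app V t = S.X₂.presheaf.map i.op s) : S.Exact := by
  rw [ShortComplex.exact_iff_epi_kernel_lift]
  refine epi_of_locally_surjective _ fun U s x hx => ?_
  have hs : S.g.app U ((kernel.ι S.g).app U s) = 0 := by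
    have := congr(Scheme.Modules.Hom.app $(kernel.condition S.g) U s)
    exact this
  obtain ⟨V, i, hV, t, ht⟩ := h U _ hs x hx
  refine ⟨V, i, hV, t, app_injective_of_mono (kernel.ι S.g) V ?_⟩
  have h1 := congr(Scheme.Modules.Hom.app $(kernel.lift_ι S.g S.f S.zero) V t)
  refine (Eq.trans ?_ (h1.trans ht)).trans ?_
  · rfl
  · exact congr($((kernel.ι S.g).mapPresheaf.naturality i.op) s).symm

/-- Multiplication by a global function, as an endomorphism of a sheaf of modules. -/
noncomputable def scalarEnd (M : X.Modules) (r : ∀ U, Γ(X, U))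
    (hr : ∀ {U V : X.Opens} (i : V ⟶ U), X.presheaf.map i.op (r U) = r V) : M ⟶ M where
  val := PresheafOfModules.homMk
    { app := fun U => AddCommGrpCat.ofHom
        { toFun := fun s => (show Γ(M, U.unop) from r U.unop • (show Γ(M, U.unop) from s))
          map_zero' := smul_zero (A := Γ(M, U.unop)) (r U.unop)
          map_add' := smul_add (A := Γ(M, U.unop)) (r U.unop) }
      naturality := fun U V i => by
        ext s
        have := M.map_smul i.unop (r U.unop) s
        rw [hr] at this
        exact this.symm } fun U a s => by
          exact smul_comm (r U.unop) (show Γ(X, U.unop) from a) (show Γ(M, U.unop) from s)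

theorem scalarEnd_naturality {M N : X.Modules} (f : M ⟶ N) (r : ∀ U, Γ(X, U))
    (hr : ∀ {U V : X.Opens} (i : V ⟶ U), X.presheaf.map i.op (r U) = r V) :
    f ≫ scalarEnd N r hr = scalarEnd M r hr ≫ f :=
  Scheme.Modules.hom_ext _ _ fun U => by
    ext s
    exact (f.app_smul (r U) s).symm

end ModuleSheaves

/-! ### Sections of twists and morphisms out of `𝒪 ⊗ E`. -/

section TwistSections

variable {A : Type u} [CommRing A] [Algebra ℂ A] {𝒜 : ℕ → Submodule ℂ A} [GradedAlgebra 𝒜]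
variable {E : Type u} [AddCommGroup E] [Module ℂ E]
variable {E' : Type u} [AddCommGroup E'] [Module ℂ E']

/-- The section of `𝒪(d) ⊗ E` given by a single fraction. -/
noncomputable def fracSection {d : ℤ} {i j : ℕ} (h : (i : ℤ) = j + d) {n : A ⊗[ℂ] E} {s : A}
    (hn : n ∈ tensorDegree 𝒜 E i) (hs : s ∈ 𝒜 j) {U : Opens (ProjectiveSpectrum 𝒜)}
    (hU : ∀ x : U, s ∈ complAt x.1) : twistSections 𝒜 E d U :=
  ⟨fun x => LocalizedModule.mk n ⟨s, hU x⟩,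
    fun x => ⟨U, x.2, 𝟙 U, i, j, n, s, h, hn, hs, fun y => ⟨hU y, rfl⟩⟩⟩

/-- The global section `1 ⊗ e` of `𝒪 ⊗ E`. -/
noncomputable def constTensor (e : E) : twistSections 𝒜 E 0 ⊤ :=
  fracSection (i := 0) (j := 0) (s := 1) (by simp)
    (tmul_mem_tensorDegree (SetLike.one_mem_graded 𝒜) e) (SetLike.one_mem_graded 𝒜)
    fun _ => one_mem _

/-- The regular function `a / s`. -/
noncomputable def fracFunction {k : ℕ} {a s : A} (ha : a ∈ 𝒜 k) (hs : s ∈ 𝒜 k)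
    {U : Opens (ProjectiveSpectrum 𝒜)} (hU : ∀ x : U, s ∈ complAt x.1) : regularFunctions 𝒜 U :=
  ⟨fun x => HomogeneousLocalization.mk ⟨k, ⟨a, ha⟩, ⟨s, hs⟩, hU x⟩,
    fun x => ⟨U, x.2, 𝟙 U, k, ⟨a, ha⟩, ⟨s, hs⟩, fun y => hU y, fun _ => rfl⟩⟩

/-- The restriction of sections. -/
def restrictSection {d : ℤ} {U V : Opens (ProjectiveSpectrum 𝒜)} (h : V ≤ U)
    (s : twistSections 𝒜 E d U) : twistSections 𝒜 E d V :=
  ⟨fun x => s.1 ⟨x.1, h x.2⟩, (locallyFraction 𝒜 E d).res (homOfLE h) s.1 s.2⟩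

/-- The map on sections induced by a morphism of twists. -/
noncomputable def twistApp {d d' : ℤ} (u : twist 𝒜 E d ⟶ twist 𝒜 E' d')
    (U : Opens (ProjectiveSpectrum 𝒜)) : twistSections 𝒜 E d U →+ twistSections 𝒜 E' d' U :=
  (u.app U).hom

theorem twistApp_restrictSection {d d' : ℤ} (u : twist 𝒜 E d ⟶ twist 𝒜 E' d')
    {U V : Opens (ProjectiveSpectrum 𝒜)} (h : V ≤ U) (s : twistSections 𝒜 E d U) :
    twistApp u V (restrictSection h s) = restrictSection h (twistApp u U s) :=
  congr($(u.mapPresheaf.naturality (X := .op U) (Y := .op V) (homOfLE h).op) s)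

theorem twistApp_smul {d d' : ℤ} (u : twist 𝒜 E d ⟶ twist 𝒜 E' d')
    {U : Opens (ProjectiveSpectrum 𝒜)} (r : regularFunctions 𝒜 U) (s : twistSections 𝒜 E d U) :
    twistApp u U (r • s) = r • twistApp u U s :=
  u.app_smul _ _

theorem twist_hom_ext_twistApp {d d' : ℤ} {u v : twist 𝒜 E d ⟶ twist 𝒜 E' d'}
    (h : ∀ (U : Opens (ProjectiveSpectrum 𝒜)) s (x : U), (twistApp u U s).1 x = (twistApp v U s).1 x) :
    u = v :=
  twist_hom_ext fun U s => Subtype.ext <| funext fun x => h U s x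

/-- A morphism from `𝒪 ⊗ E` is determined by its values on the global sections `1 ⊗ e`. -/
theorem twist_hom_ext_of_constTensor {d' : ℤ} {u v : twist 𝒜 E 0 ⟶ twist 𝒜 E' d'}
    (h : ∀ e : E, twistApp u ⊤ (constTensor e) = twistApp v ⊤ (constTensor e)) : u = v := by
  refine twist_hom_ext_twistApp fun U s x => ?_
  obtain ⟨k, i, t, n, hV, hk, hi, ht, hn, htx, e⟩ := exists_local_fraction s le_rfl x.2
  obtain rfl : i = k := by omega
  let D := ProjectiveSpectrum.basicOpen 𝒜 t
  -- Numerator and denominator have the same degree, so the fraction is a sum of terms `(a / t) • (1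
  -- ⊗ e)` with regular coefficients `a / t`.
  have key : ∀ w : twistSections 𝒜 E 0 D, (∀ y : D, w.1 y = LocalizedModule.mk n ⟨t, y.2⟩) →
      twistApp u D w = twistApp v D w := by
    refine tensorDegree_induction (p := fun n => ∀ w : twistSections 𝒜 E 0 D,
      (∀ y : D, w.1 y = LocalizedModule.mk n ⟨t, y.2⟩) →
      twistApp u D w = twistApp v D w) ?_ ?_ ?_ hn
    · intro w hw
      have : w = 0 := Subtype.ext <| funext fun y => (hw y).trans (LocalizedModule.zero_mk _)
      rw [this, map_zero, map_zero]
    · intro a ha e w hw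
      have : w = fracFunction ha ht (U := D) (fun y => y.2) •
          restrictSection le_top (constTensor e) := by
        refine Subtype.ext <| funext fun y => (hw y).trans ?_
        refine Eq.trans ?_ (LocalizedModule.mk_smul_mk ..).symm
        simp [TensorProduct.smul_tmul']
      rw [this, twistApp_smul, twistApp_smul, twistApp_restrictSection, twistApp_restrictSection, h]
    · intro n₁ h₁ n₂ h₂ e₁ e₂ w hw
      have : w = fracSection (by simp) h₁ ht (U := D) (fun y => y.2) +
          fracSection (by simp) h₂ ht (U := D) (fun y => y.2) := by
        refine Subtype.ext <| funext fun y => (hw y).trans ?_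
        rw [IsLocalizedModule.mk_eq_mk', IsLocalizedModule.mk'_add, ← IsLocalizedModule.mk_eq_mk',
          ← IsLocalizedModule.mk_eq_mk']
        rfl
      rw [this, map_add, map_add, e₁ _ fun _ => rfl, e₂ _ fun _ => rfl]
  have h1 := key (restrictSection hV s) fun y => (smul_eq_toLocAt_iff y.2).1 (e y.1 y.2)
  rw [twistApp_restrictSection, twistApp_restrictSection] at h1
  exact congr(($h1).1 ⟨x.1, htx⟩)

theorem twistApp_comp {E'' : Type u} [AddCommGroup E''] [Module ℂ E''] {d d' d'' : ℤ}
    (u : twist 𝒜 E d ⟶ twist 𝒜 E' d') (v : twist 𝒜 E' d' ⟶ twist 𝒜 E'' d'')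
    (U : Opens (ProjectiveSpectrum 𝒜)) (s : twistSections 𝒜 E d U) :
    twistApp (u ≫ v) U s = twistApp v U (twistApp u U s) := rfl

theorem twistApp_zero {d d' : ℤ} (U : Opens (ProjectiveSpectrum 𝒜)) (s : twistSections 𝒜 E d U) :
    twistApp (0 : twist 𝒜 E d ⟶ twist 𝒜 E' d') U s = 0 := rfl

theorem twistApp_twistMap {d d' : ℤ} (f : A ⊗[ℂ] E →ₗ[A] A ⊗[ℂ] E') {m : ℕ} (hd : d' = d + m)
    (hf : ∀ i, ∀ n ∈ tensorDegree 𝒜 E i, f n ∈ tensorDegree 𝒜 E' (i + m))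
    {U : Opens (ProjectiveSpectrum 𝒜)} (s : twistSections 𝒜 E d U) (x : U) :
    (twistApp (twistMap f hd hf) U s).1 x = LocalizedModule.map (complAt x.1) f (s.1 x) := rfl

theorem constTensor_apply (e : E) (x : (⊤ : Opens (ProjectiveSpectrum 𝒜))) :
    (constTensor e : twistSections 𝒜 E 0 ⊤).1 x = toLocAt x.1 (1 ⊗ₜ e) := rfl

theorem map_toLocAt (f : A ⊗[ℂ] E →ₗ[A] A ⊗[ℂ] E') (x : ProjectiveSpectrum 𝒜) (n : A ⊗[ℂ] E) :
    LocalizedModule.map (complAt x) f (toLocAt x n) = toLocAt x (f n) :=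
  LocalizedModule.map_mk ..

variable (𝒜) in
/-- The constant function, as a regular function. -/
noncomputable def constFunction (c : ℂ) (U : Opens (ProjectiveSpectrum 𝒜)) :
    regularFunctions 𝒜 U :=
  constSection 𝒜 c U

theorem valueAt_constFunction_smul (c : ℂ) {U : Opens (ProjectiveSpectrum 𝒜)} (x : U)
    (f : LocAt 𝒜 E x.1) :
    valueAt (constFunction 𝒜 c U) x • f =
      algebraMap ℂ A c • f := by
  induction f using LocalizedModule.induction_on with
  | h n t =>
    refine (LocalizedModule.mk_smul_mk ..).trans ?_
    rw [LocalizedModule.smul'_mk]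
    congr 1
    exact one_mul _

theorem constTensor_add (e e' : E) : (constTensor (e + e') : twistSections 𝒜 E 0 ⊤) =
    constTensor e + constTensor e' :=
  Subtype.ext <| funext fun x => by
    refine (constTensor_apply (e + e') x).trans ?_
    rw [TensorProduct.tmul_add, map_add]
    rfl

theorem constTensor_smul (c : ℂ) (e : E) : (constTensor (c • e) : twistSections 𝒜 E 0 ⊤) =
    constFunction 𝒜 c ⊤ • (constTensor e : twistSections 𝒜 E 0 ⊤) :=
  Subtype.ext <| funext fun x => by
    refine (constTensor_apply (c • e) x).trans (Eq.trans ?_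
      (valueAt_constFunction_smul (𝒜 := 𝒜) c x _).symm)
    rw [constTensor_apply (𝒜 := 𝒜), ← map_smul, TensorProduct.tmul_smul, TensorProduct.smul_tmul',
      TensorProduct.smul_tmul', smul_eq_mul, mul_one, Algebra.smul_def, mul_one]

end TwistSections

/-! ### Reconstructing Clifford-linear maps from their even and odd parts. -/

namespace GradedCliffordModule

variable {V : Type u} [AddCommGroup V] [Module ℂ V] {q : QuadraticForm ℂ V}

/-- Multiplication by a vector, from the odd part to the even part. -/
noncomputable def actOdd (M : GradedCliffordModule q) (v : V) : M.grading 1 →ₗ[ℂ] M.grading 0 :=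
  (Module.toModuleEnd ℂ (S := CliffordAlgebra q) M.carrier (CliffordAlgebra.ι q v)).restrict
    fun _ hm => M.smul_mem (j := 1) (CliffordAlgebra.ι_mem_evenOdd_one q v) hm

theorem coe_act (M : GradedCliffordModule q) (v : V) (m : M.grading 0) :
    (M.act v m : M.carrier) = CliffordAlgebra.ι q v • (m : M.carrier) := rfl

theorem coe_actOdd (M : GradedCliffordModule q) (v : V) (m : M.grading 1) :
    (M.actOdd v m : M.carrier) = CliffordAlgebra.ι q v • (m : M.carrier) := rfl

theorem ι_smul_ι_smul_add_swap (M : GradedCliffordModule q) (v w : V) (m : M.carrier) :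
    CliffordAlgebra.ι q v • CliffordAlgebra.ι q w • m +
      CliffordAlgebra.ι q w • CliffordAlgebra.ι q v • m =
      (2 * QuadraticMap.associated (R := ℂ) q v w) • m := by
  rw [smul_smul, smul_smul, ← add_smul, CliffordAlgebra.ι_mul_ι_add_swap, algebraMap_smul,
    QuadraticMap.associated_apply]
  congr 1
  rw [QuadraticMap.polar]
  simp

theorem ι_smul_ι_smul (M : GradedCliffordModule q) (v : V) (m : M.carrier) :
    CliffordAlgebra.ι q v • CliffordAlgebra.ι q v • m = q v • m := by
  rw [smul_smul, CliffordAlgebra.ι_sq_scalar, algebraMap_smul]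

/-- The square of `v` acts as the invertible scalar `q v`. -/
theorem eq_of_ι_smul_eq (M : GradedCliffordModule q) {v : V} (hv : q v ≠ 0) {m m' : M.carrier}
    (h : CliffordAlgebra.ι q v • m = CliffordAlgebra.ι q v • m') : m = m' := by
  have := congr(CliffordAlgebra.ι q v • $h)
  rw [ι_smul_ι_smul, ι_smul_ι_smul] at this
  exact smul_right_injective _ hv this

theorem act_injective (M : GradedCliffordModule q) {v : V} (hv : q v ≠ 0) :
    Function.Injective (M.act v) := fun _ _ h =>
  Subtype.ext (M.eq_of_ι_smul_eq hv congr(($h : M.carrier)))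

theorem act_add (M : GradedCliffordModule q) (v w : V) : M.act (v + w) = M.act v + M.act w :=
  LinearMap.ext fun m => Subtype.ext <| by
    rw [LinearMap.add_apply, Submodule.coe_add, coe_act, coe_act, coe_act, map_add, add_smul]

theorem act_smul (M : GradedCliffordModule q) (c : ℂ) (v : V) : M.act (c • v) = c • M.act v :=
  LinearMap.ext fun m => Subtype.ext <| by
    rw [LinearMap.smul_apply, Submodule.coe_smul, coe_act, coe_act, map_smul, smul_assoc]

/-- Multiplication from the even part to the odd part, as a linear map in the vector. -/
noncomputable def actLin (M : GradedCliffordModule q) :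
    V →ₗ[ℂ] M.grading 0 →ₗ[ℂ] M.grading 1 where
  toFun := M.act
  map_add' := M.act_add
  map_smul' := M.act_smul

theorem isCompl (M : GradedCliffordModule q) : IsCompl (M.grading 0) (M.grading 1) :=
  M.isInternal.isCompl (by decide) (by
    refine Set.eq_univ_of_forall (fun i => ?_) |>.symm
    fin_cases i
    · exact Or.inl rfl
    · exact Or.inr rfl)

theorem exists_eq_add (M : GradedCliffordModule q) (m : M.carrier) :
    ∃ (m₀ : M.grading 0) (m₁ : M.grading 1), m = m₀ + m₁ := by
  obtain ⟨m₀, h₀, m₁, h₁, h⟩ := Submodule.mem_sup.1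
    (M.isCompl.sup_eq_top ▸ Submodule.mem_top : m ∈ M.grading 0 ⊔ M.grading 1)
  exact ⟨⟨m₀, h₀⟩, ⟨m₁, h₁⟩, h.symm⟩

/-- A homomorphism of graded Clifford modules is determined by its odd part. -/
theorem hom_ext_odd (hq : q ≠ 0) {M N : GradedCliffordModule q} {f g : M ⟶ N}
    (h : homPart f 1 = homPart g 1) : f = g := by
  obtain ⟨v, hv⟩ : ∃ v, q v ≠ 0 := by
    by_contra! h
    exact hq (QuadraticMap.ext h)
  have h1 (m : M.grading 1) : f.1 m = g.1 m := congr(($h m : N.carrier))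
  refine Subtype.ext (LinearMap.ext fun m => ?_)
  obtain ⟨m₀, m₁, rfl⟩ := M.exists_eq_add m
  rw [map_add, map_add, h1]
  congr 1
  refine N.eq_of_ι_smul_eq hv ?_
  rw [← map_smul, ← map_smul]
  exact h1 (M.act v m₀)

/-- A pair of linear maps compatible with the multiplication by vectors from the even part to the
odd part is a homomorphism of graded Clifford modules. -/
theorem exists_hom (hq : q ≠ 0) {M N : GradedCliffordModule q}
    (f₀ : M.grading 0 →ₗ[ℂ] N.grading 0) (f₁ : M.grading 1 →ₗ[ℂ] N.grading 1)
    (h : ∀ v m, f₁ (M.act v m) = N.act v (f₀ m)) : ∃ f : M ⟶ N, homPart f 1 = f₁ := by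
  obtain ⟨e, he⟩ : ∃ v, q v ≠ 0 := by
    by_contra! h
    exact hq (QuadraticMap.ext h)
  -- For anisotropic `v`, multiply by `v`: `v f₀(v m) = f₁(v v m) = q(v) f₁(m) = v v f₁(m)`.
  have hgood (v : V) (hv : q v ≠ 0) (m : M.grading 1) :
      (f₀ (M.actOdd v m) : N.carrier) = CliffordAlgebra.ι q v • (f₁ m : N.carrier) := by
    refine N.eq_of_ι_smul_eq hv ?_
    rw [ι_smul_ι_smul, ← coe_act, ← h]
    have : M.act v (M.actOdd v m) = q v • m := Subtype.ext (M.ι_smul_ι_smul v m)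
    rw [this, map_smul]
    rfl
  -- For arbitrary `v`, apply `f₁` to the polarized relation `e v m + v e m = 2 B(e, v) m`. The term
  -- with `f₀(e m)` is already known, so it cancels and leaves `e f₀(v m) = e v f₁(m)`.
  have hodd (v : V) (m : M.grading 1) :
      (f₀ (M.actOdd v m) : N.carrier) = CliffordAlgebra.ι q v • (f₁ m : N.carrier) := by
    refine N.eq_of_ι_smul_eq he ?_
    have h1 : M.act e (M.actOdd v m) + M.act v (M.actOdd e m) =
        (2 * QuadraticMap.associated (R := ℂ) q e v) • m :=
      Subtype.ext (M.ι_smul_ι_smul_add_swap e v m)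
    have h2 := congr((f₁ $h1 : N.carrier))
    rw [map_add, h, h, map_smul, Submodule.coe_add, Submodule.coe_smul, coe_act, coe_act,
      hgood e he, ← N.ι_smul_ι_smul_add_swap e v (f₁ m)] at h2
    exact add_right_cancel h2
  let F : M.carrier →ₗ[ℂ] N.carrier := LinearMap.ofIsCompl M.isCompl
    ((N.grading 0).subtype ∘ₗ f₀) ((N.grading 1).subtype ∘ₗ f₁)
  have hF₀ (m : M.grading 0) : F m = f₀ m := LinearMap.ofIsCompl_apply_left _ m
  have hF₁ (m : M.grading 1) : F m = f₁ m := LinearMap.ofIsCompl_apply_right _ m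
  have hι (v : V) (m : M.carrier) :
      F (CliffordAlgebra.ι q v • m) = CliffordAlgebra.ι q v • F m := by
    obtain ⟨m₀, m₁, rfl⟩ := M.exists_eq_add m
    rw [smul_add, map_add, map_add, smul_add, ← coe_act, ← coe_actOdd, hF₀, hF₁, hF₀, hF₁, h,
      hodd, coe_act]
  have hcl (a : CliffordAlgebra q) (m : M.carrier) : F (a • m) = a • F m := by
    induction a using CliffordAlgebra.induction generalizing m with
    | algebraMap c => rw [algebraMap_smul, algebraMap_smul, map_smul]
    | ι v => exact hι v m
    | mul a b ha hb => rw [mul_smul, mul_smul, ha, hb]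
    | add a b ha hb => rw [add_smul, add_smul, map_add, ha, hb]
  refine ⟨⟨{ F with map_smul' := hcl }, fun i m hm => ?_⟩,
    LinearMap.ext fun m => Subtype.ext (hF₁ m)⟩
  fin_cases i
  · exact (hF₀ ⟨m, hm⟩).symm ▸ (f₀ ⟨m, hm⟩).2
  · exact (hF₁ ⟨m, hm⟩).symm ▸ (f₁ ⟨m, hm⟩).2

end GradedCliffordModule

/-! ### From graded modules to twists: exactness, and morphisms given by linear maps. -/

section TwistMorphisms

variable {A : Type u} [CommRing A] [Algebra ℂ A] {𝒜 : ℕ → Submodule ℂ A} [GradedAlgebra 𝒜]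
variable {E E' F F' : Type u} [AddCommGroup E] [Module ℂ E] [AddCommGroup E'] [Module ℂ E']
  [AddCommGroup F] [Module ℂ F] [AddCommGroup F'] [Module ℂ F']

theorem twistMap_comp_twistMap_eq_zero {d d' d'' : ℤ} {m m' : ℕ}
    {f : A ⊗[ℂ] E →ₗ[A] A ⊗[ℂ] E'} {g : A ⊗[ℂ] E' →ₗ[A] A ⊗[ℂ] F} (hd : d' = d + m)
    (hd' : d'' = d' + m')
    (hf : ∀ i, ∀ n ∈ tensorDegree 𝒜 E i, f n ∈ tensorDegree 𝒜 E' (i + m))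
    (hg : ∀ i, ∀ n ∈ tensorDegree 𝒜 E' i, g n ∈ tensorDegree 𝒜 F (i + m'))
    (h : ∀ n, g (f n) = 0) : twistMap f hd hf ≫ twistMap g hd' hg = 0 := by
  refine twist_hom_ext_twistApp fun U s x => ?_
  rw [twistApp_comp, twistApp_twistMap, twistApp_twistMap, twistApp_zero]
  induction (s.1 x) using LocalizedModule.induction_on with
  | h n t =>
    rw [LocalizedModule.map_mk, LocalizedModule.map_mk, h]
    exact LocalizedModule.zero_mk t

theorem map_smul_locAt (f : A ⊗[ℂ] E →ₗ[A] A ⊗[ℂ] E') (x : ProjectiveSpectrum 𝒜) (a : A)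
    (p : LocAt 𝒜 E x) : LocalizedModule.map (complAt x) f (a • p) =
      a • LocalizedModule.map (complAt x) f p := by
  induction p using LocalizedModule.induction_on with
  | h n t => rw [LocalizedModule.smul'_mk, LocalizedModule.map_mk, LocalizedModule.map_mk,
      LocalizedModule.smul'_mk, map_smul]

/-- Exactness passes from graded modules to sheaves by clearing denominators. If `g` kills `n / t`
on `D(t)`, then `t ^ N • n` is killed by `g` for some `N`, so it is `f p`, and `p / t ^ (N + 1)` is
a preimage. -/
theorem exists_local_lift {d d' : ℤ} {m : ℕ} {f : A ⊗[ℂ] E →ₗ[A] A ⊗[ℂ] E'}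
    {g : A ⊗[ℂ] E' →ₗ[A] A ⊗[ℂ] F} (hd : (0 : ℤ) = d + (1 : ℕ)) (hd' : d' = 0 + m)
    (hf : ∀ i, ∀ n ∈ tensorDegree 𝒜 E i, f n ∈ tensorDegree 𝒜 E' (i + 1))
    (hg : ∀ i, ∀ n ∈ tensorDegree 𝒜 E' i, g n ∈ tensorDegree 𝒜 F (i + m))
    (hfg : ∀ i, ∀ n ∈ tensorDegree 𝒜 E' (i + 1), g n = 0 → ∃ p ∈ tensorDegree 𝒜 E i, n = f p)
    {U : Opens (ProjectiveSpectrum 𝒜)} (s : twistSections 𝒜 E' 0 U)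
    (hs : twistApp (twistMap g hd' hg) U s = 0) (x : U) :
    ∃ (D : Opens (ProjectiveSpectrum 𝒜)) (h : D ≤ U), x.1 ∈ D ∧
      ∃ r, twistApp (twistMap f hd hf) D r = restrictSection h s := by
  obtain ⟨k, i, t, n, hV, hk, hi, ht, hn, htx, e⟩ := exists_local_fraction s le_rfl x.2
  obtain rfl : i = k := by omega
  have hzero (y : ProjectiveSpectrum 𝒜) (hy : t ∈ complAt y) : toLocAt y (g n) = 0 := by
    have h1 := congr(($hs).1 ⟨y, hV hy⟩)
    rw [twistApp_twistMap] at h1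
    rw [← map_toLocAt, ← e y hy, map_smul_locAt]
    exact congr(t • $h1).trans (smul_zero _)
  obtain ⟨N, hN⟩ := exists_pow_smul_eq_zero (hg _ _ hn) ht hk hzero
  rw [← map_smul] at hN
  -- The denominator has positive degree, hence so does this numerator; exactness is available only
  -- in degrees of the form `i + 1`.
  have htn : t ^ N • n ∈ tensorDegree 𝒜 E' ((N * i + i - 1) + 1) := by
    rw [Nat.sub_add_cancel (by omega)]
    exact smul_mem_tensorDegree (SetLike.pow_mem_graded N ht) hn
  obtain ⟨p, hp, hpn⟩ := hfg _ _ htn hN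
  have htN : t ^ (N + 1) ∈ 𝒜 (N * i + i) := by
    rw [← Nat.succ_mul]
    exact SetLike.pow_mem_graded (N + 1) ht
  refine ⟨ProjectiveSpectrum.basicOpen _ t, hV, htx,
    fracSection (by omega) hp htN fun y => pow_mem (S := complAt y.1) y.2 (N + 1),
    Subtype.ext <| funext fun y => ?_⟩
  rw [twistApp_twistMap]
  refine (LocalizedModule.map_mk ..).trans ?_
  rw [← hpn]
  refine ((smul_eq_toLocAt_iff (pow_mem (S := complAt y.1) y.2 (N + 1))).1 ?_).symm
  rw [pow_succ, mul_smul, map_smul]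
  congr 1
  exact e y.1 y.2

theorem twistMap_exact {d d' : ℤ} {m : ℕ} {f : A ⊗[ℂ] E →ₗ[A] A ⊗[ℂ] E'}
    {g : A ⊗[ℂ] E' →ₗ[A] A ⊗[ℂ] F} (hd : (0 : ℤ) = d + (1 : ℕ)) (hd' : d' = 0 + m)
    (hf : ∀ i, ∀ n ∈ tensorDegree 𝒜 E i, f n ∈ tensorDegree 𝒜 E' (i + 1))
    (hg : ∀ i, ∀ n ∈ tensorDegree 𝒜 E' i, g n ∈ tensorDegree 𝒜 F (i + m))
    (hfg : ∀ i, ∀ n ∈ tensorDegree 𝒜 E' (i + 1), g n = 0 → ∃ p ∈ tensorDegree 𝒜 E i, n = f p)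
    (h : twistMap f hd hf ≫ twistMap g hd' hg = 0) : (ShortComplex.mk _ _ h).Exact :=
  exact_of_locally_exact _ fun U s hs x hx => by
    obtain ⟨D, hD, hxD, r, hr⟩ := exists_local_lift hd hd' hf hg hfg (U := U) s hs ⟨x, hx⟩
    exact ⟨D, homOfLE hD, hxD, r, hr⟩

theorem twistApp_twistBaseChange (d : ℤ) (f : E →ₗ[ℂ] E') {U : Opens (ProjectiveSpectrum 𝒜)}
    (s : twistSections 𝒜 E d U) (x : U) :
    (twistApp (twistBaseChange 𝒜 d f) U s).1 x =
      LocalizedModule.map (complAt x.1) (f.baseChange A) (s.1 x) := rfl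

theorem twistApp_twistBaseChange_constTensor (f : E →ₗ[ℂ] E') (e : E) :
    twistApp (twistBaseChange 𝒜 0 f) ⊤ (constTensor e) = constTensor (f e) :=
  Subtype.ext <| funext fun x => by
    rw [twistApp_twistBaseChange, constTensor_apply, constTensor_apply, map_toLocAt,
      LinearMap.baseChange_tmul]

theorem twistBaseChange_comp_twistMap_constTensor {d' : ℤ} {m : ℕ} (f : E →ₗ[ℂ] E')
    {g : A ⊗[ℂ] E' →ₗ[A] A ⊗[ℂ] F} (hd' : d' = 0 + m)
    (hg : ∀ i, ∀ n ∈ tensorDegree 𝒜 E' i, g n ∈ tensorDegree 𝒜 F (i + m)) (e : E)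
    (x : (⊤ : Opens (ProjectiveSpectrum 𝒜))) :
    (twistApp (twistBaseChange 𝒜 0 f ≫ twistMap g hd' hg) ⊤ (constTensor e)).1 x =
      toLocAt x.1 (g (1 ⊗ₜ f e)) := by
  rw [twistApp_comp, twistApp_twistBaseChange_constTensor, twistApp_twistMap, constTensor_apply,
    map_toLocAt]

theorem twistApp_constTensor_smul {d' : ℤ} (u : twist 𝒜 E 0 ⟶ twist 𝒜 E' d') (c : ℂ) (e : E)
    (x : (⊤ : Opens (ProjectiveSpectrum 𝒜))) :
    (twistApp u ⊤ (constTensor (c • e))).1 x =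
      algebraMap ℂ A c • (twistApp u ⊤ (constTensor e)).1 x := by
  rw [constTensor_smul, twistApp_smul]
  exact valueAt_constFunction_smul c x _

theorem one_tmul_smul (c : ℂ) (e : E) :
    (1 : A) ⊗ₜ[ℂ] (c • e) = algebraMap ℂ A c • ((1 : A) ⊗ₜ[ℂ] e) := by
  rw [algebraMap_smul, TensorProduct.tmul_smul]

theorem twistBaseChange_add (f f' : E →ₗ[ℂ] E') :
    twistBaseChange 𝒜 0 (f + f') = twistBaseChange 𝒜 0 f + twistBaseChange 𝒜 0 f' := by
  refine twist_hom_ext_of_constTensor fun e => ?_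
  have (u v : twist 𝒜 E 0 ⟶ twist 𝒜 E' 0) (s : twistSections 𝒜 E 0 ⊤) :
    twistApp (u + v) ⊤ s = twistApp u ⊤ s + twistApp v ⊤ s := rfl
  rw [this, twistApp_twistBaseChange_constTensor, twistApp_twistBaseChange_constTensor,
    twistApp_twistBaseChange_constTensor, ← constTensor_add, LinearMap.add_apply]

theorem constSection_restrict (c : ℂ) {U V : (Proj 𝒜).Opens} (i : V ⟶ U) :
    (Proj 𝒜).presheaf.map i.op (constSection 𝒜 c U) = constSection 𝒜 c V := rfl

/-- Scalars act on morphisms of sheaves by composition with multiplication by a constant function.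
-/
theorem twistBaseChange_smul (c : ℂ) (f : E →ₗ[ℂ] E') :
    twistBaseChange 𝒜 0 (c • f) = twistBaseChange 𝒜 0 f ≫
      scalarEnd _ (constSection 𝒜 c) (constSection_restrict c) := by
  refine twist_hom_ext_of_constTensor fun e => ?_
  have (s : twistSections 𝒜 E' 0 ⊤) :
    twistApp (scalarEnd _ (constSection 𝒜 c) (constSection_restrict c)) ⊤ s =
      constFunction 𝒜 c ⊤ • s := rfl
  rw [twistApp_comp, this, twistApp_twistBaseChange_constTensor,
    twistApp_twistBaseChange_constTensor, LinearMap.smul_apply, constTensor_smul]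

namespace IsDeterminingFamily

variable {K : Type*} {y : K → A} {k₀ : K}

theorem eq_of_toLocAt (hy : IsDeterminingFamily 𝒜 y k₀) {m : ℕ} {g : A ⊗[ℂ] E' →ₗ[A] A ⊗[ℂ] F}
    (hg : ∀ i, ∀ n ∈ tensorDegree 𝒜 E' i, g n ∈ tensorDegree 𝒜 F (i + m))
    (hinj : ∀ e : E', g (1 ⊗ₜ e) = 0 → e = 0) {e e' : E'}
    (h : ∀ x : ProjectiveSpectrum 𝒜, toLocAt x (g (1 ⊗ₜ e)) = toLocAt x (g (1 ⊗ₜ e'))) :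
    e = e' := by
  refine sub_eq_zero.1 (hinj _ (hy.eq_zero_of_toLocAt
    (hg 0 _ (tmul_mem_tensorDegree (SetLike.one_mem_graded 𝒜) _)) fun x => ?_))
  rw [TensorProduct.tmul_sub, map_sub, map_sub, h, sub_self]

theorem twistBaseChange_comp_injective (hy : IsDeterminingFamily 𝒜 y k₀) {d' : ℤ} {m : ℕ}
    {g : A ⊗[ℂ] E' →ₗ[A] A ⊗[ℂ] F} (hd' : d' = 0 + m)
    (hg : ∀ i, ∀ n ∈ tensorDegree 𝒜 E' i, g n ∈ tensorDegree 𝒜 F (i + m))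
    (hinj : ∀ e : E', g (1 ⊗ₜ e) = 0 → e = 0) {f f' : E →ₗ[ℂ] E'}
    (h : twistBaseChange 𝒜 0 f ≫ twistMap g hd' hg = twistBaseChange 𝒜 0 f' ≫ twistMap g hd' hg) :
    f = f' := by
  refine LinearMap.ext fun e => hy.eq_of_toLocAt hg hinj fun x => ?_
  have h2 := congr((twistApp $h ⊤ (constTensor e)).1 ⟨x, Opens.mem_top x⟩)
  rwa [twistBaseChange_comp_twistMap_constTensor, twistBaseChange_comp_twistMap_constTensor] at h2

/-- A morphism `𝒪 ⊗ E ⟶ 𝒪(1) ⊗ F` with values in the kernel of a morphism to a twist factors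
through a linear map if the kernel is generated in degree zero. -/
theorem exists_eq_twistBaseChange_comp (hy : IsDeterminingFamily 𝒜 y k₀) {d' : ℤ} {m' : ℕ}
    {g : A ⊗[ℂ] E' →ₗ[A] A ⊗[ℂ] F} {h : A ⊗[ℂ] F →ₗ[A] A ⊗[ℂ] F'}
    (hd : (1 : ℤ) = 0 + (1 : ℕ)) (hd' : d' = 1 + m')
    (hg : ∀ i, ∀ n ∈ tensorDegree 𝒜 E' i, g n ∈ tensorDegree 𝒜 F (i + 1))
    (hh : ∀ i, ∀ n ∈ tensorDegree 𝒜 F i, h n ∈ tensorDegree 𝒜 F' (i + m'))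
    (hinj : ∀ e : E', g (1 ⊗ₜ e) = 0 → e = 0)
    (hgh : ∀ n ∈ tensorDegree 𝒜 F 1, h n = 0 → ∃ e : E', n = g (1 ⊗ₜ e))
    (G : twist 𝒜 E 0 ⟶ twist 𝒜 F 1) (hG : G ≫ twistMap h hd' hh = 0) :
    ∃ f : E →ₗ[ℂ] E', G = twistBaseChange 𝒜 0 f ≫ twistMap g hd hg := by
  have key (e : E) : ∃ e' : E', ∀ x,
      (twistApp G ⊤ (constTensor e)).1 x = toLocAt x.1 (g (1 ⊗ₜ e')) := by
    obtain ⟨n, hn, hnx⟩ := hy.exists_eq_toLocAt (twistApp G ⊤ (constTensor e))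
    have h0 : h n = 0 := by
      refine hy.eq_zero_of_toLocAt (hh _ _ hn) fun x => ?_
      rw [← map_toLocAt]
      refine congr(LocalizedModule.map (complAt x) h $(hnx ⟨x, Opens.mem_top x⟩)).symm.trans ?_
      exact congr((twistApp $hG ⊤ (constTensor e)).1 ⟨x, Opens.mem_top x⟩)
    obtain ⟨e', rfl⟩ := hgh n hn h0
    exact ⟨e', hnx⟩
  choose f hf using key
  -- The element chosen for each `e` is unique by `eq_of_toLocAt`, which forces linearity.
  let f' : E →ₗ[ℂ] E' :=
    { toFun := f
      map_add' := fun e e' => hy.eq_of_toLocAt hg hinj fun x => by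
        have h1 := hf (e + e') ⟨x, Opens.mem_top x⟩
        rw [constTensor_add, map_add] at h1
        rw [← h1, TensorProduct.tmul_add, map_add, map_add]
        exact congrArg₂ _ (hf e ⟨x, Opens.mem_top x⟩) (hf e' ⟨x, Opens.mem_top x⟩)
      map_smul' := fun c e => hy.eq_of_toLocAt hg hinj fun x => by
        rw [RingHom.id_apply, one_tmul_smul, map_smul, map_smul]
        refine (hf (c • e) ⟨x, Opens.mem_top x⟩).symm.trans
          ((twistApp_constTensor_smul G c e ⟨x, Opens.mem_top x⟩).trans ?_)
        exact congr(algebraMap ℂ A c • $(hf e ⟨x, Opens.mem_top x⟩)) }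
  refine ⟨f', twist_hom_ext_of_constTensor fun e => Subtype.ext <| funext fun x => ?_⟩
  rw [twistBaseChange_comp_twistMap_constTensor]
  exact hf e x

/-- Here `d = -1`, and `1 ⊗ e` is not a section of `𝒪(-1) ⊗ E`. The composite is tested instead on
the local sections `(1 ⊗ e) / y k`, and the denominator is then cleared. -/
theorem apply_eq_zero_of_comp_eq_zero (hy : IsDeterminingFamily 𝒜 y k₀) {d : ℤ} {d' : ℤ} {m : ℕ}
    {f : A ⊗[ℂ] E →ₗ[A] A ⊗[ℂ] E'} {g : A ⊗[ℂ] F →ₗ[A] A ⊗[ℂ] F'}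
    (hd : (0 : ℤ) = d + (1 : ℕ)) (hd' : d' = 0 + m)
    (hf : ∀ i, ∀ n ∈ tensorDegree 𝒜 E i, f n ∈ tensorDegree 𝒜 E' (i + 1))
    (hg : ∀ i, ∀ n ∈ tensorDegree 𝒜 F i, g n ∈ tensorDegree 𝒜 F' (i + m)) {l : E' →ₗ[ℂ] F}
    (h : twistMap f hd hf ≫ twistBaseChange 𝒜 0 l ≫ twistMap g hd' hg = 0) (e : E) :
    g (l.baseChange A (f (1 ⊗ₜ e))) = 0 := by
  have he : (1 : A) ⊗ₜ[ℂ] e ∈ tensorDegree 𝒜 E 0 :=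
    tmul_mem_tensorDegree (SetLike.one_mem_graded 𝒜) e
  refine hy.eq_zero_of_toLocAt (hg _ _ (baseChange_mem_tensorDegree l _ _ (hf _ _ he))) fun x => ?_
  obtain ⟨k, hk⟩ := hy.cover x
  let s : twistSections 𝒜 E d (ProjectiveSpectrum.basicOpen 𝒜 (y k)) :=
    fracSection (i := 0) (j := 1) (by omega) he (hy.mem k) fun z => z.2
  have h1 := congr((twistApp $h _ s).1 ⟨x, hk⟩)
  rw [twistApp_comp, twistApp_comp, twistApp_twistMap, twistApp_twistBaseChange,
    twistApp_twistMap] at h1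
  have h2 : y k • s.1 ⟨x, hk⟩ = toLocAt x (1 ⊗ₜ e) := (smul_eq_toLocAt_iff hk).2 rfl
  have h3 := congr(y k • $h1)
  rw [← map_smul_locAt, ← map_smul_locAt, ← map_smul_locAt, h2, map_toLocAt,
    map_toLocAt, map_toLocAt] at h3
  exact h3.trans (smul_zero _)

end IsDeterminingFamily

end TwistMorphisms

/-! ### The embedding of spinor sheaves into twists, and full faithfulness. -/

section SpinorSheaves

open GradedCliffordModule Limits

variable {V ι : Type u} [AddCommGroup V] [Module ℂ V] [Fintype ι] (b : Module.Basis ι ℂ V)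
  {q : QuadraticForm ℂ V}

/-- The map `r ⊗ η ↦ ∑ xᵢ r ⊗ bᵢ η` on odd parts. -/
noncomputable def psiLin (M : GradedCliffordModule q) :
    coordRing b q ⊗[ℂ] M.grading 1 →ₗ[coordRing b q] coordRing b q ⊗[ℂ] M.grading 0 :=
  linearMatrix (coordFn b q) fun i => M.actOdd (b i)

theorem phiLin_eq (M : GradedCliffordModule q) :
    phiLin b M = linearMatrix (coordFn b q) fun i => M.act (b i) := rfl

theorem isCliffordPair_even (M : GradedCliffordModule q) :
    IsCliffordPair b q (fun i => M.act (b i)) fun i => M.actOdd (b i) := fun i j m =>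
  Subtype.ext (M.ι_smul_ι_smul_add_swap (b i) (b j) m)

theorem isCliffordPair_odd (M : GradedCliffordModule q) :
    IsCliffordPair b q (fun i => M.actOdd (b i)) fun i => M.act (b i) := fun i j m =>
  Subtype.ext (M.ι_smul_ι_smul_add_swap (b i) (b j) m)

theorem psiLin_mem (M : GradedCliffordModule q) (i : ℕ) (n : coordRing b q ⊗[ℂ] M.grading 1)
    (hn : n ∈ tensorDegree (coordGrading b q) (M.grading 1) i) :
    psiLin b M n ∈ tensorDegree (coordGrading b q) (M.grading 0) (i + 1) :=
  linearMatrix_mem _ (coord_mem b q) hn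

/-- The map `𝒪 ⊗ M_odd ⟶ 𝒪(1) ⊗ M_ev`. -/
noncomputable def psi (M : GradedCliffordModule q) :
    twist (coordGrading b q) (M.grading 1) 0 ⟶ twist (coordGrading b q) (M.grading 0) 1 :=
  twistMap (psiLin b M) (m := 1) (by simp) (psiLin_mem b M)

/-- The map `𝒪(1) ⊗ M_ev ⟶ 𝒪(2) ⊗ M_odd`. -/
noncomputable def phiOne (M : GradedCliffordModule q) :
    twist (coordGrading b q) (M.grading 0) 1 ⟶ twist (coordGrading b q) (M.grading 1) 2 :=
  twistMap (phiLin b M) (m := 1) (by norm_num) (phiLin_mem b M)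

theorem phi_psi (M : GradedCliffordModule q) : phi b M ≫ psi b M = 0 :=
  twistMap_comp_twistMap_eq_zero _ _ _ _ (isCliffordPair_even b M).comp_eq_zero

theorem psi_phiOne (M : GradedCliffordModule q) : psi b M ≫ phiOne b M = 0 :=
  twistMap_comp_twistMap_eq_zero _ _ _ _ (isCliffordPair_odd b M).comp_eq_zero

theorem psiLin_one_tmul_injective (hq : q ≠ 0) (M : GradedCliffordModule q) (m : M.grading 1)
    (h : psiLin b M (1 ⊗ₜ m) = 0) : m = 0 :=
  (isCliffordPair_even b M).one_tmul_injective hq (isCliffordPair_odd b M) h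

/-- The spinor sheaf as a subsheaf of `𝒪(1) ⊗ M_ev`. -/
noncomputable def spinorInclusion (M : GradedCliffordModule q) :
    (spinorSheaf b q).obj M ⟶ twist (coordGrading b q) (M.grading 0) 1 :=
  cokernel.desc (phi b M) (psi b M) (phi_psi b M)

/-- The spinor sheaf as a quotient of `𝒪 ⊗ M_odd`. -/
noncomputable def spinorProjection (M : GradedCliffordModule q) :
    twist (coordGrading b q) (M.grading 1) 0 ⟶ (spinorSheaf b q).obj M :=
  cokernel.π (phi b M)

instance (M : GradedCliffordModule q) : Epi (spinorProjection b M) :=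
  inferInstanceAs (Epi (cokernel.π (phi b M)))

theorem spinorProjection_spinorInclusion (M : GradedCliffordModule q) :
    spinorProjection b M ≫ spinorInclusion b M = psi b M :=
  cokernel.π_desc _ _ _

theorem phi_spinorProjection (M : GradedCliffordModule q) :
    phi b M ≫ spinorProjection b M = 0 :=
  cokernel.condition _

theorem spinorProjection_map {M N : GradedCliffordModule q} (f : M ⟶ N) :
    spinorProjection b M ≫ (spinorSheaf b q).map f =
      twistBaseChange _ 0 (homPart f 1) ≫ spinorProjection b N :=
  cokernel.π_desc _ _ _

theorem spinorInclusion_phiOne (M : GradedCliffordModule q) :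
    spinorInclusion b M ≫ phiOne b M = 0 := by
  rw [← cancel_epi (spinorProjection b M), ← Category.assoc, spinorProjection_spinorInclusion,
    psi_phiOne, comp_zero]

/-- Exactness at `𝒪 ⊗ M_odd` says that the kernel of `ψ` is the image of `φ`, so `ψ` is injective on
the cokernel of `φ`. -/
theorem mono_spinorInclusion (hq : q ≠ 0) (M : GradedCliffordModule q) :
    Mono (spinorInclusion b M) := by
  have hex : (ShortComplex.mk _ _ (phi_psi b M)).Exact :=
    twistMap_exact _ _ _ _ (fun _ _ => (isCliffordPair_even b M).exists_mem hq
      (isCliffordPair_odd b M)) (phi_psi b M)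
  exact hex.mono_cokernelDesc

section DeterminingFamily

variable {b} {K : Type u} {y : K → coordRing b q} {k₀ : K}
  (hy : IsDeterminingFamily (coordGrading b q) y k₀)
include hy

theorem spinorSheaf_map_injective (hq : q ≠ 0) {M N : GradedCliffordModule q} {f g : M ⟶ N}
    (h : (spinorSheaf b q).map f = (spinorSheaf b q).map g) : f = g := by
  refine hom_ext_odd hq (hy.twistBaseChange_comp_injective (d' := 1) (m := 1) (by simp)
    (psiLin_mem b N) (psiLin_one_tmul_injective b hq N) ?_)
  have h1 := congr(spinorProjection b M ≫ $h ≫ spinorInclusion b N)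
  rw [← Category.assoc, ← Category.assoc, spinorProjection_map, spinorProjection_map,
    Category.assoc, Category.assoc, spinorProjection_spinorInclusion] at h1
  exact h1

/-- A morphism `𝒪 ⊗ M_odd ⟶ 𝒪(1) ⊗ N_ev` with values in the spinor sheaf of `N` is induced by a
linear map between the odd parts. -/
theorem exists_eq_twistBaseChange_psi (hq : q ≠ 0) {M N : GradedCliffordModule q}
    (G : twist (coordGrading b q) (M.grading 1) 0 ⟶ twist (coordGrading b q) (N.grading 0) 1)
    (hG : G ≫ phiOne b N = 0) :
    ∃ f : M.grading 1 →ₗ[ℂ] N.grading 1, G = twistBaseChange _ 0 f ≫ psi b N := by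
  refine hy.exists_eq_twistBaseChange_comp (by simp) (by norm_num) (psiLin_mem b N)
    (phiLin_mem b N) (psiLin_one_tmul_injective b hq N) (fun n hn h0 => ?_) G hG
  -- A degree one element of the kernel of `φ` is `ψ` of an element of degree zero, and `A₀ = ℂ`.
  obtain ⟨n', hn', h⟩ := (isCliffordPair_odd b N).exists_mem hq (isCliffordPair_even b N) hn h0
  obtain ⟨m', rfl⟩ := exists_eq_one_tmul hn'
  exact ⟨m', h⟩

/-- The element `(1 ⊗ f) (φ (1 ⊗ m))` has degree one and is killed by `ψ`, so it is `φ (1 ⊗ m')`.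
The coordinates are linearly independent in `A₁`, so coefficients can be compared. -/
theorem exists_even_part (hq : q ≠ 0) {M N : GradedCliffordModule q}
    (f : M.grading 1 →ₗ[ℂ] N.grading 1) (h : phi b M ≫ twistBaseChange _ 0 f ≫ psi b N = 0)
    (m : M.grading 0) : ∃ m' : N.grading 0, ∀ v, f (M.act v m) = N.act v m' := by
  have hn : f.baseChange (coordRing b q) (phiLin b M (1 ⊗ₜ m)) ∈
      tensorDegree (coordGrading b q) (N.grading 1) 1 :=
    baseChange_mem_tensorDegree f 1 _ (phiLin_mem b M 0 _ (one_tmul_mem m))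
  have h0 : psiLin b N (f.baseChange (coordRing b q) (phiLin b M (1 ⊗ₜ m))) = 0 :=
    hy.apply_eq_zero_of_comp_eq_zero (by simp) (by simp) (phiLin_mem b M) (psiLin_mem b N) h m
  obtain ⟨n', hn', e⟩ := (isCliffordPair_even b N).exists_mem hq (isCliffordPair_odd b N) hn h0
  obtain ⟨m', rfl⟩ := exists_eq_one_tmul hn'
  refine ⟨m', fun v => ?_⟩
  have hb (i : ι) : f (M.act (b i) m) = N.act (b i) m' := by
    refine sub_eq_zero.1 (eq_zero_of_sum_tmul_eq_zero (linearIndependent_coordFn (b := b) (q := q))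
      (e := fun i => f (M.act (b i) m) - N.act (b i) m') ?_ i)
    rw [phiLin_eq, linearMatrix_tmul, linearMatrix_tmul, map_sum] at e
    simp only [mul_one, LinearMap.baseChange_tmul] at e
    simp only [TensorProduct.tmul_sub, Finset.sum_sub_distrib, e, sub_self]
  have : f ∘ₗ M.actLin.flip m = N.actLin.flip m' := b.ext hb
  exact congr($this v)

theorem exists_map_eq (hq : q ≠ 0) {M N : GradedCliffordModule q}
    (g : (spinorSheaf b q).obj M ⟶ (spinorSheaf b q).obj N) :
    ∃ f : M ⟶ N, (spinorSheaf b q).map f = g := by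
  obtain ⟨v, hv⟩ : ∃ v, q v ≠ 0 := by
    by_contra! h
    exact hq (QuadraticMap.ext h)
  -- The composite `𝒪 ⊗ M_odd → S → S' → 𝒪(1) ⊗ N_ev` determines `g`, since the first map is epi and
  -- the last is mono.
  obtain ⟨f₁, hf₁⟩ := exists_eq_twistBaseChange_psi hy hq
    (spinorProjection b M ≫ g ≫ spinorInclusion b N) (by
      rw [Category.assoc, Category.assoc, spinorInclusion_phiOne, comp_zero, comp_zero])
  have h := exists_even_part hy hq f₁ (by
    rw [← hf₁, ← Category.assoc, phi_spinorProjection, zero_comp])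
  choose f₀ hf₀ using h
  -- Linearity of the chosen `f₀` can be checked after acting by one anisotropic `v`, where it
  -- becomes linearity of `f₁`.
  let f₀' : M.grading 0 →ₗ[ℂ] N.grading 0 :=
    { toFun := f₀
      map_add' := fun m m' => N.act_injective hv (by
        rw [map_add, ← hf₀, ← hf₀, ← hf₀, map_add, map_add])
      map_smul' := fun c m => N.act_injective hv (by
        rw [map_smul, ← hf₀, ← hf₀, map_smul, map_smul, RingHom.id_apply]) }
  obtain ⟨f, hf⟩ := exists_hom hq f₀' f₁ fun v m => hf₀ m v
  refine ⟨f, ?_⟩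
  have := mono_spinorInclusion b hq N
  rw [← cancel_epi (spinorProjection b M), ← cancel_mono (spinorInclusion b N), Category.assoc,
    Category.assoc, hf₁, ← Category.assoc, spinorProjection_map, Category.assoc,
    spinorProjection_spinorInclusion, hf]

end DeterminingFamily

theorem spinorSheaf_map_add {M N : GradedCliffordModule q} (f g : M ⟶ N) :
    (spinorSheaf b q).map (f + g) = (spinorSheaf b q).map f + (spinorSheaf b q).map g := by
  have h : homPart (f + g) 1 = homPart f 1 + homPart g 1 := rfl
  rw [← cancel_epi (spinorProjection b M), Preadditive.comp_add, spinorProjection_map,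
    spinorProjection_map, spinorProjection_map, h, twistBaseChange_add, Preadditive.add_comp]

theorem spinorSheaf_map_smul {M N : GradedCliffordModule q} (c : ℂ) (f : M ⟶ N) :
    (spinorSheaf b q).map (c • f) = (spinorSheaf b q).map f ≫
      scalarEnd _ (constSection (coordGrading b q) c) (constSection_restrict c) := by
  have h : homPart (c • f) 1 = c • homPart f 1 := rfl
  rw [← cancel_epi (spinorProjection b M), spinorProjection_map, ← Category.assoc,
    spinorProjection_map, Category.assoc, scalarEnd_naturality, h, twistBaseChange_smul,
    Category.assoc]

end SpinorSheaves

end SpinorSheaf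

theorem mainTheorem1 {V ι : Type u} [AddCommGroup V] [Module ℂ V] [Fintype ι]
    (b : Module.Basis ι ℂ V) (q : QuadraticForm ℂ V) (hq : q ≠ 0)
    (hV : 2 ≤ Module.finrank ℂ V) :
    (∀ (W W' : Submodule ℂ V), (∀ v ∈ W, q v = 0) → (∀ v ∈ W', q v = 0) →
      ∀ {m m' : ℕ} (w : Module.Basis (Fin m) ℂ W) (w' : Module.Basis (Fin m') ℂ W'),
        Function.Bijective fun f : idealModule q (fun i => (w i : V)) ⟶
            idealModule q (fun i => (w' i : V)) => (spinorSheaf b q).map f) ∧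
    (spinorSheaf b q).Full ∧ (spinorSheaf b q).Faithful ∧
    (∀ (M N : GradedCliffordModule q) (f g : M ⟶ N),
      (spinorSheaf b q).map (f + g) = (spinorSheaf b q).map f + (spinorSheaf b q).map g) ∧
    (∀ (M N : GradedCliffordModule q) (c : ℂ) (f : M ⟶ N) (U : (quadric b q).Opens)
      (s : Γ((spinorSheaf b q).obj M, U)),
      ((spinorSheaf b q).map (c • f)).app U s =
        constSection (coordGrading b q) c U • ((spinorSheaf b q).map f).app U s) := by
  obtain ⟨K, y, k₀, hy⟩ := exists_isDeterminingFamily (b := b) hq hV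
  have inj {M N : GradedCliffordModule q} :
      Function.Injective fun f : M ⟶ N => (spinorSheaf b q).map f :=
    fun _ _ h => spinorSheaf_map_injective hy hq h
  have surj {M N : GradedCliffordModule q} :
      Function.Surjective fun f : M ⟶ N => (spinorSheaf b q).map f :=
    fun g => exists_map_eq hy hq g
  -- The left ideals are graded Clifford modules, so the first claim is an instance of the general
  -- one.
  refine ⟨fun W W' _ _ m m' w w' => ⟨inj, surj⟩, ⟨fun {_ _} => surj⟩, ⟨fun {_ _} => inj⟩,
    fun M N f g => spinorSheaf_map_add b f g, fun M N c f U s => ?_⟩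
  rw [spinorSheaf_map_smul]
  rfl
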